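/- Let $[k]=\{1,\dots,k\}$ and let $U_k$ be the uniform distribution on $[k]$. A streaming algorithm $\mathcal A$ consists of a (randomized) initial internal state, a randomized update rule that maps an internal state and a stream element from $[k]$ to a new internal state, and a randomized output rule that is applied to the internal state at the end of the stream and answers "uniform" or "non-uniform"; the space of internal states is arbitrary. Given a stream $s=(s_1,\dots,s_m)\in[k]^m$, let $M_t(s)$ be the internal state after the first $t$ elements and $O(s)$ the output at the end of the stream. $\mathcal A$ is $\varepsilon$-pan-private (on streams of length $m$) if for any two streams $s,s'\in[k]^m$ that differ in at most one element, any time $1\le t\le m$ and any (measurable) set $E$ of pairs of an internal state and an output, $$\Pr[(M_t(s),O(s))\in E]\le e^{\varepsilon}\,\Pr[(M_t(s'),O(s'))\in E].$$ $\mathcal A$ is a uniformity tester on $m$ samples with distance parameter $\alpha$ if, on a stream of $m$ i.i.d. samples from a distribution $p$ on $[k]$, it answers "uniform" with probability at least $2/3$ when $p=U_k$, and "non-uniform" with probability at least $2/3$ whenever $\|p-U_k\|_{TV}\ge\alpha$, where $\|p-q\|_{TV}=\frac12\sum_{i=1}^k|p(i)-q(i)|$. Theorem. For every constant $\varepsilon_0$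 there is a constant $c>0$, depending only on $\varepsilon_0$, such that for all integers $k\ge 2$ and $m\ge 0$ and all real numbers $0<\varepsilon\le\varepsilon_0$ and $0<\alpha\le 1/2$: every $\varepsilon$-pan-private uniformity tester over $[k]$ on $m$ samples with distance parameter $\alpha$ satisfies $$m\;\ge\; c\left(\frac{k^{2/3}}{\alpha^{4/3}\varepsilon^{2/3}}+\frac{\sqrt k}{\alpha^{2}}+\frac{1}{\alpha\varepsilon}\right).$$ -/

import Mathlib

open MeasureTheory ProbabilityTheory
open scoped ENNReal ProbabilityTheory

noncomputable section

/-- A randomized one-pass streaming algorithm over the data universe `X`, with internal states in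
`I` and outputs in `O`: a random initial state, a randomized update rule that maps an internal
state and a stream element to a new internal state, and a randomized output rule that is applied
to the internal state at the end of the stream. -/
structure StreamAlgorithm (X I O : Type*)
    [MeasurableSpace X] [MeasurableSpace I] [MeasurableSpace O] where
  /-- the law of the state before the first stream element -/
  init : Measure I
  /-- the law of the new state, given the old state and the stream element -/
  step : Kernel (I × X) I
  /-- the law of the output, given the final state -/
  output : Kernel I O
  isProbabilityMeasure_init : IsProbabilityMeasure init
  isMarkovKernel_step : IsMarkovKernel step
  isMarkovKernel_output : IsMarkovKernel output

namespace StreamAlgorithm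

variable {X I O : Type*} [MeasurableSpace X] [MeasurableSpace I] [MeasurableSpace O]

instance (A : StreamAlgorithm X I O) : IsProbabilityMeasure A.init := A.isProbabilityMeasure_init
instance (A : StreamAlgorithm X I O) : IsMarkovKernel A.step := A.isMarkovKernel_step
instance (A : StreamAlgorithm X I O) : IsMarkovKernel A.output := A.isMarkovKernel_output

/-- The law of the internal state reached after processing the stream elements in the list, in
order, starting from a given internal state. -/
def run (A : StreamAlgorithm X I O) : List X → Kernel I I
  | [] => Kernel.id
  | x :: xs => run A xs ∘ₖ A.step.sectL x

instance (A : StreamAlgorithm X I O) (l : List X) : IsMarkovKernel (A.run l) := by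
  induction l with
  | nil => unfold run; infer_instance
  | cons x xs ih => unfold run; infer_instance

/-- The law of the internal state after processing the stream elements in `l` from the start. -/
def stateLaw (A : StreamAlgorithm X I O) (l : List X) : Measure I := A.run l ∘ₘ A.init

instance (A : StreamAlgorithm X I O) (l : List X) : IsProbabilityMeasure (A.stateLaw l) := by
  unfold stateLaw; infer_instance

/-- The law of the output on the stream `l`. -/
def outputLaw (A : StreamAlgorithm X I O) (l : List X) : Measure O := A.output ∘ₘ A.stateLaw l

instance (A : StreamAlgorithm X I O) (l : List X) : IsProbabilityMeasure (A.outputLaw l) := by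
  unfold outputLaw; infer_instance

/-- The joint law of the internal state after the first `t` elements of the stream `l` and of the
output at the end of `l`: the output is produced by continuing, from the state at time `t`, with
the remaining stream elements. -/
def viewLaw (A : StreamAlgorithm X I O) (l : List X) (t : ℕ) : Measure (I × O) :=
  A.stateLaw (l.take t) ⊗ₘ (A.output ∘ₖ A.run (l.drop t))

instance (A : StreamAlgorithm X I O) (l : List X) (t : ℕ) :
    IsProbabilityMeasure (A.viewLaw l t) := by
  unfold viewLaw; infer_instance

/-- `A` is `ε`-pan-private on streams of length `m`: for any two streams `s`, `s'` that differ in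
a single element and any time `t` of an intrusion (right after the `t`-th element has been
processed), the pair (internal state at time `t`, final output) is an `ε`-differentially private
function of the stream. -/
def PanPrivate (A : StreamAlgorithm X I O) (m : ℕ) (ε : ℝ) : Prop :=
  ∀ (s s' : Fin m → X) (j : Fin m), (∀ i, i ≠ j → s i = s' i) →
    ∀ t : ℕ, 1 ≤ t → t ≤ m → ∀ E : Set (I × O), MeasurableSet E →
      A.viewLaw (List.ofFn s) t E ≤
        ENNReal.ofReal (Real.exp ε) * A.viewLaw (List.ofFn s') t E

end StreamAlgorithm

/-- The two answers of a uniformity tester. -/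
inductive Verdict
  | uniform
  | nonUniform

instance : MeasurableSpace Verdict := ⊤

instance : DiscreteMeasurableSpace Verdict := ⟨fun _ => trivial⟩

/-- Total variation distance of two distributions on a finite set. -/
def tvDist {X : Type*} [Fintype X] (p q : PMF X) : ℝ :=
  (1 / 2) * ∑ x, |(p x).toReal - (q x).toReal|

/-- The probability that `A` answers `v` on a stream of `m` i.i.d. samples from `p`. -/
def answerProb {k : ℕ} {I : Type*} [MeasurableSpace I]
    (A : StreamAlgorithm (Fin k) I Verdict) (m : ℕ) (p : PMF (Fin k)) (v : Verdict) : ℝ≥0∞ :=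
  ∫⁻ s : Fin m → Fin k, A.outputLaw (List.ofFn s) {v} ∂(Measure.pi fun _ => p.toMeasure)

/-- `A` is a uniformity tester over a domain of size `k`, with distance parameter `α`, on `m`
samples. -/
def IsUniformityTester {k : ℕ} [NeZero k] {I : Type*} [MeasurableSpace I]
    (A : StreamAlgorithm (Fin k) I Verdict) (α : ℝ) (m : ℕ) : Prop :=
  2 / 3 ≤ answerProb A m (PMF.uniformOfFintype (Fin k)) Verdict.uniform ∧
    ∀ p : PMF (Fin k), α ≤ tvDist p (PMF.uniformOfFintype (Fin k)) →
      2 / 3 ≤ answerProb A m p Verdict.nonUniform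

end

/-!
The lower bound has three terms, and each comes from a bound on how well the algorithm can tell the
uniform distribution from a suitable alternative.

The term `1 / (α ε)` needs a single alternative, the mixture of the uniform distribution with a point
mass. A private state changes its law by a factor of at most `1 + τ (e ^ ε - 1)` when the law of one
sample is changed by `τ` in total variation, hence by at most `exp (m τ (e ^ ε - 1))` when all `m`
samples are exchanged one after the other (`iidMean_le_of_stable`,
`StreamAlgorithm.PanPrivate.iidMean_stateMean_le`).

The other two terms come from a random alternative. The universe is split into pairs, and a random
sign vector `Z` decides for each pair which element gets the factor `1 + a` and which one `1 - a`,
with `a` of order `α`. Each alternative is far from uniform, so the answer "non-uniform" has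
probability at least `2 / 3` under the mixture of the `m`-fold products, and at most about `1 / 3`
under the base distribution. Then the second moment of the likelihood ratio of the two is bounded
away from `1`. There are two upper bounds on this second moment:

* On the whole stream it is at most the mean of `exp (m a² ∑ i, v i Z i Z' i)` over independent sign
  vectors `Z` and `Z'`, with `v i` of order `1 / k`, and this is `exp (O(m² a⁴ / k))`
  (`BlockPerturbation.sq_sum_iidMean_le`). This gives the term `√k / α²`.
* On the final state, it is bounded by following the state through time
  (`StreamAlgorithm.PanPrivate.sq_sum_iidMean_stateMean_le`). Flipping one sign moves the law of a
  sample by `O(a / k)`, so by privacy the posterior mean of each sign given the state at time `t` is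
  at most `θ = O(m a ε / k)` in absolute value, for every value of the state
  (`StreamAlgorithm.PanPrivate.exists_posterior`). Given the state, the next sample therefore has
  density `1 ± a θ` relative to the base distribution, and one step multiplies the second moment by
  at most `1 + a² θ²`. After `m` steps it is at most `exp (O(m³ a⁴ ε² / k²))`, which gives the term
  `k ^ (2 / 3) / (α ^ (4 / 3) ε ^ (2 / 3))`.

If `k` is odd, one element is left over by the pairing. For small `α` it keeps its mass. For large
`α` this would leave the alternatives too close to uniform, and it gets mass zero instead; the base
distribution is then at distance `1 / k` from uniform, which by the first argument is harmless unless
`m` is of order `k / ε`, and in that case all bounds hold anyway (`pairing_bounds`).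

The second moments are used in dual form: a bound `K` on the second moment of the density of `P`
with respect to `Q` is the inequality `(∫ f dP)² ≤ K ∫ f² dQ` for all functions `f` with values in
`[0, 1]`. In these inequalities the mixture over the `N = 2 ^ card ι` sign vectors is not normalised,
so that a factor `N²` appears on the right.
-/

/-! ### Expectations over i.i.d. streams, and the hybrid argument -/

section Iid

variable {X : Type*} [Fintype X]

/-- The expectation of `F` over a stream of `t` i.i.d. samples, where `x` is drawn with
probability `p x`. -/
def iidMean (p : X → ℝ) (t : ℕ) (F : (Fin t → X) → ℝ) : ℝ :=
  ∑ s, (∏ i, p (s i)) * F s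

theorem iidMean_zero (p : X → ℝ) (F : (Fin 0 → X) → ℝ) : iidMean p 0 F = F ![] := by
  simp [iidMean, Matrix.empty_eq]

theorem iidMean_succ (p : X → ℝ) (t : ℕ) (F : (Fin (t + 1) → X) → ℝ) :
    iidMean p (t + 1) F =
      iidMean p t fun s => ∑ x, p x * F (Fin.snoc (α := fun _ => X) s x) := by
  unfold iidMean
  rw [← (Fin.snocEquiv fun _ : Fin (t + 1) => X).sum_comp, Fintype.sum_prod_type_right]
  refine Finset.sum_congr rfl fun s _ => ?_
  rw [Finset.mul_sum]
  refine Finset.sum_congr rfl fun x _ => ?_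
  simp [Fin.snocEquiv, Fin.prod_univ_castSucc]
  ring

theorem iidMean_succ' (p : X → ℝ) (t : ℕ) (F : (Fin (t + 1) → X) → ℝ) :
    iidMean p (t + 1) F =
      ∑ x, p x * iidMean p t fun s => F (Fin.snoc (α := fun _ => X) s x) := by
  rw [iidMean_succ]
  simp only [iidMean, Finset.mul_sum]
  rw [Finset.sum_comm]
  exact Finset.sum_congr rfl fun x _ => Finset.sum_congr rfl fun s _ => by ring

theorem iidMean_mono {p : X → ℝ} (hp : ∀ x, 0 ≤ p x) {t : ℕ} {F G : (Fin t → X) → ℝ}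
    (h : ∀ s, F s ≤ G s) : iidMean p t F ≤ iidMean p t G :=
  Finset.sum_le_sum fun s _ =>
    mul_le_mul_of_nonneg_left (h s) (Finset.prod_nonneg fun _ _ => hp _)

theorem iidMean_nonneg {p : X → ℝ} (hp : ∀ x, 0 ≤ p x) {t : ℕ} {F : (Fin t → X) → ℝ}
    (h : ∀ s, 0 ≤ F s) : 0 ≤ iidMean p t F :=
  Finset.sum_nonneg fun s _ => mul_nonneg (Finset.prod_nonneg fun _ _ => hp _) (h s)

theorem iidMean_const_mul (p : X → ℝ) {t : ℕ} (c : ℝ) (F : (Fin t → X) → ℝ) :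
    iidMean p t (fun s => c * F s) = c * iidMean p t F := by
  simp only [iidMean, Finset.mul_sum]
  exact Finset.sum_congr rfl fun s _ => by ring

/-- Changing the law of one sample by `τ` in total variation changes the mean of a function whose
values are all within a factor `C` of each other by a factor of at most `1 + τ (C - 1)`. -/
theorem sum_mul_le_of_stable {p p' F : X → ℝ} (hp' : ∀ x, 0 ≤ p' x)
    (hp1 : ∑ x, p x = 1) (hp1' : ∑ x, p' x = 1) {τ C : ℝ}
    (hτ : (1 / 2) * ∑ x, |p x - p' x| ≤ τ) (hC : 1 ≤ C) (hF : ∀ x, 0 ≤ F x)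
    (hFC : ∀ x y, F x ≤ C * F y) :
    ∑ x, p x * F x ≤ (1 + τ * (C - 1)) * ∑ x, p' x * F x := by
  have hne : Nonempty X := by
    by_contra h
    rw [not_nonempty_iff] at h
    simp at hp1
  obtain ⟨z, hz⟩ := Finite.exists_min F
  have hτ0 : 0 ≤ τ := le_trans (by positivity) hτ
  have hmin : F z ≤ ∑ x, p' x * F x := by
    calc F z = ∑ x, p' x * F z := by rw [← Finset.sum_mul, hp1', one_mul]
      _ ≤ _ := Finset.sum_le_sum fun x _ => mul_le_mul_of_nonneg_left (hz x) (hp' x)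
  -- Both laws have mass one, so `F` may be recentred at the middle of its range.
  have hdiff : ∑ x, p x * F x - ∑ x, p' x * F x
      = ∑ x, (p x - p' x) * (F x - (1 + C) / 2 * F z) := by
    simp only [mul_sub, sub_mul, Finset.sum_sub_distrib, ← Finset.sum_mul, hp1, hp1']
    ring
  have hbound : ∑ x, (p x - p' x) * (F x - (1 + C) / 2 * F z)
      ≤ ∑ x, |p x - p' x| * ((C - 1) / 2 * F z) := by
    refine Finset.sum_le_sum fun x _ => ?_
    refine (le_abs_self _).trans ?_
    rw [abs_mul]
    refine mul_le_mul_of_nonneg_left ?_ (abs_nonneg _)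
    rw [abs_le]
    constructor <;> nlinarith [hz x, hFC x z]
  rw [← Finset.sum_mul] at hbound
  have h1 : (∑ x, |p x - p' x|) * ((C - 1) / 2 * F z) ≤ τ * (C - 1) * F z := by
    have : 0 ≤ (C - 1) * F z := mul_nonneg (by linarith) (hF z)
    nlinarith
  have h2 : τ * (C - 1) * F z ≤ τ * (C - 1) * ∑ x, p' x * F x :=
    mul_le_mul_of_nonneg_left hmin (mul_nonneg hτ0 (by linarith))
  linarith

/-- The hybrid argument: the samples are exchanged one after the other. -/
theorem iidMean_le_of_stable [DecidableEq X] {p p' : X → ℝ} (hp : ∀ x, 0 ≤ p x)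
    (hp' : ∀ x, 0 ≤ p' x)
    (hp1 : ∑ x, p x = 1) (hp1' : ∑ x, p' x = 1) {τ C : ℝ}
    (hτ : (1 / 2) * ∑ x, |p x - p' x| ≤ τ) (hC : 1 ≤ C) :
    ∀ (t : ℕ) (F : (Fin t → X) → ℝ), (∀ s, 0 ≤ F s) →
      (∀ (s s' : Fin t → X) (j : Fin t), (∀ i, i ≠ j → s i = s' i) → F s ≤ C * F s') →
      iidMean p t F ≤ (1 + τ * (C - 1)) ^ t * iidMean p' t F := by
  have hτ0 : 0 ≤ τ := le_trans (by positivity) hτ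
  have hfac : 0 ≤ 1 + τ * (C - 1) := by nlinarith
  intro t
  induction t with
  | zero => intro F _ _; simp [iidMean_zero]
  | succ t ih =>
    intro F hF hFC
    rw [iidMean_succ, iidMean_succ]
    calc iidMean p t (fun s => ∑ x, p x * F (Fin.snoc (α := fun _ => X) s x))
        ≤ iidMean p t (fun s =>
            (1 + τ * (C - 1)) * ∑ x, p' x * F (Fin.snoc (α := fun _ => X) s x)) := by
          refine iidMean_mono hp fun s => ?_
          refine sum_mul_le_of_stable hp' hp1 hp1' hτ hC (fun x => hF _) fun x y => ?_
          refine hFC _ _ (Fin.last t) fun i hi => ?_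
          obtain ⟨i, rfl⟩ := Fin.exists_castSucc_eq.2 hi
          simp
      _ = (1 + τ * (C - 1)) *
            iidMean p t (fun s => ∑ x, p' x * F (Fin.snoc (α := fun _ => X) s x)) :=
          iidMean_const_mul _ _ _
      _ ≤ (1 + τ * (C - 1)) * ((1 + τ * (C - 1)) ^ t *
            iidMean p' t (fun s => ∑ x, p' x * F (Fin.snoc (α := fun _ => X) s x))) := by
          refine mul_le_mul_of_nonneg_left (ih _ ?_ ?_) hfac
          · exact fun s => Finset.sum_nonneg fun x _ => mul_nonneg (hp' x) (hF _)
          · intro s s' j hs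
            rw [Finset.mul_sum]
            refine Finset.sum_le_sum fun x _ => ?_
            have := hFC (Fin.snoc (α := fun _ => X) s x) (Fin.snoc (α := fun _ => X) s' x)
              j.castSucc ?_
            · nlinarith [hp' x]
            · intro i
              refine Fin.lastCases ?_ (fun i => ?_) i
              · simp
              · intro hi
                simpa using hs i (fun h => hi (by rw [h]))
      _ = _ := by ring

end Iid

/-! ### Paired perturbations of a base distribution -/

/-- The real sign attached to a Boolean. -/
def boolSign (b : Bool) : ℝ := if b then 1 else -1

theorem abs_boolSign (b : Bool) : |boolSign b| = 1 := by
  cases b <;> simp [boolSign]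

theorem boolSign_mul_self (b : Bool) : boolSign b * boolSign b = 1 := by
  cases b <;> simp [boolSign]

theorem boolSign_not (b : Bool) : boolSign (!b) = -boolSign b := by
  cases b <;> simp [boolSign]

/-- A family of perturbations of a distribution `base` on `X`, indexed by the sign vectors
`Z : ι → Bool`. The universe is partitioned into blocks, and the probability of `x` is multiplied by
`1 ± amp * dir x`, with the sign that `Z` assigns to the block of `x`. The direction `dir` is
balanced in each block, so that each perturbation is again a distribution. -/
structure BlockPerturbation (X ι : Type*) [Fintype X] [DecidableEq ι] where
  /-- the unperturbed distribution -/
  base : X → ℝ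
  /-- the direction of the perturbation, relative to `base` -/
  dir : X → ℝ
  /-- the block of an element -/
  block : X → ι
  /-- the size of the perturbation -/
  amp : ℝ
  base_nonneg : ∀ x, 0 ≤ base x
  base_sum : ∑ x, base x = 1
  amp_nonneg : 0 ≤ amp
  amp_le_one : amp ≤ 1
  abs_dir_le_one : ∀ x, |dir x| ≤ 1
  balanced : ∀ i, ∑ x with block x = i, base x * dir x = 0

namespace BlockPerturbation

variable {X ι : Type*} [Fintype X] [DecidableEq ι] (D : BlockPerturbation X ι)

/-- The perturbed distribution with sign vector `Z`. -/
def pert (Z : ι → Bool) (x : X) : ℝ :=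
  D.base x * (1 + D.amp * (D.dir x * boolSign (Z (D.block x))))

theorem abs_amp_mul_le_one (Z : ι → Bool) (x : X) :
    |D.amp * (D.dir x * boolSign (Z (D.block x)))| ≤ 1 := by
  rw [abs_mul, abs_mul, abs_boolSign, mul_one, abs_of_nonneg D.amp_nonneg]
  exact mul_le_one₀ D.amp_le_one (abs_nonneg _) (D.abs_dir_le_one x)

theorem factor_nonneg (Z : ι → Bool) (x : X) :
    0 ≤ 1 + D.amp * (D.dir x * boolSign (Z (D.block x))) := by
  linarith [(abs_le.1 (D.abs_amp_mul_le_one Z x)).1]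

theorem pert_nonneg (Z : ι → Bool) (x : X) : 0 ≤ D.pert Z x :=
  mul_nonneg (D.base_nonneg x) (D.factor_nonneg Z x)

/-- Flipping the sign of one block. -/
def flip (i : ι) (Z : ι → Bool) : ι → Bool := Function.update Z i (!Z i)

theorem flip_involutive (i : ι) : Function.Involutive (flip i) := by
  intro Z
  ext j
  by_cases h : j = i
  · subst h; simp [flip]
  · simp [flip, h]

theorem boolSign_flip (i : ι) (Z : ι → Bool) : boolSign (flip i Z i) = -boolSign (Z i) := by
  simp [flip, boolSign_not]

/-- Flipping the sign of one block moves a perturbation by at most `amp` times the mass of that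
block in total variation. -/
theorem tv_flip_le {w : ℝ} (hw : ∀ i, ∑ x with D.block x = i, D.base x * |D.dir x| ≤ w)
    (i : ι) (Z : ι → Bool) :
    (1 / 2) * ∑ x, |D.pert Z x - D.pert (flip i Z) x| ≤ D.amp * w := by
  have h : ∀ x, |D.pert Z x - D.pert (flip i Z) x|
      = if D.block x = i then 2 * D.amp * (D.base x * |D.dir x|) else 0 := by
    intro x
    split_ifs with hx
    · have : D.pert Z x - D.pert (flip i Z) x
          = 2 * D.amp * (D.base x * D.dir x) * boolSign (Z i) := by
        unfold pert
        rw [hx, boolSign_flip]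
        ring
      rw [this, abs_mul, abs_boolSign, abs_mul, abs_mul, abs_mul, abs_of_nonneg D.amp_nonneg,
        abs_of_nonneg (D.base_nonneg x)]
      simp
    · simp [pert, flip, hx]
  simp only [h]
  rw [← Finset.sum_filter, ← Finset.mul_sum]
  have := mul_le_mul_of_nonneg_left (hw i) D.amp_nonneg
  linarith

variable [Fintype ι]

/-- Since the direction is balanced in each block, it is orthogonal, in the inner product weighted by
`base`, to all functions that are constant on blocks. -/
theorem sum_base_mul_dir_mul (g : ι → ℝ) :
    ∑ x, D.base x * D.dir x * g (D.block x) = 0 := by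
  rw [← Finset.sum_fiberwise Finset.univ D.block]
  refine Finset.sum_eq_zero fun i _ => ?_
  rw [← zero_mul (g i), ← D.balanced i, Finset.sum_mul]
  refine Finset.sum_congr rfl fun x hx => ?_
  rw [(Finset.mem_filter.1 hx).2]

theorem pert_sum (Z : ι → Bool) : ∑ x, D.pert Z x = 1 := by
  have h := D.sum_base_mul_dir_mul fun i => boolSign (Z i)
  calc ∑ x, D.pert Z x
      = ∑ x, D.base x + D.amp * ∑ x, D.base x * D.dir x * boolSign (Z (D.block x)) := by
        rw [Finset.mul_sum, ← Finset.sum_add_distrib]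
        exact Finset.sum_congr rfl fun x _ => by unfold pert; ring
    _ = 1 := by rw [h, D.base_sum]; ring

theorem sum_flip (i : ι) (g : (ι → Bool) → ℝ) : ∑ Z, g (flip i Z) = ∑ Z, g Z :=
  (flip_involutive i).toPerm.bijective.sum_comp g

/-- The Cauchy-Schwarz inequality for the predictive distribution of the next sample, whose density
relative to `base` is `1 + amp * dir * r`. -/
theorem sum_mul_le_sqrt {θ : ℝ} (r : ι → ℝ)
    (hr : ∀ i, |r i| ≤ θ) (g : X → ℝ) :
    ∑ x, D.base x * ((1 + D.amp * D.dir x * r (D.block x)) * g x)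
      ≤ √(1 + D.amp ^ 2 * θ ^ 2) * √(∑ x, D.base x * g x ^ 2) := by
  set e : X → ℝ := fun x => 1 + D.amp * D.dir x * r (D.block x) with he
  have hcs : (∑ x, D.base x * (e x * g x)) ^ 2
      ≤ (∑ x, D.base x * e x ^ 2) * ∑ x, D.base x * g x ^ 2 :=
    Finset.sum_sq_le_sum_mul_sum_of_sq_le_mul _
      (fun x _ => mul_nonneg (D.base_nonneg x) (sq_nonneg _))
      (fun x _ => mul_nonneg (D.base_nonneg x) (sq_nonneg _)) fun x _ => le_of_eq (by ring)
  have he2 : ∑ x, D.base x * e x ^ 2 ≤ 1 + D.amp ^ 2 * θ ^ 2 := by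
    have h0 := D.sum_base_mul_dir_mul r
    have h1 : ∑ x, D.base x * e x ^ 2 = 1 + ∑ x, D.base x * (D.amp ^ 2 *
        (D.dir x ^ 2 * r (D.block x) ^ 2)) := by
      calc ∑ x, D.base x * e x ^ 2
          = ∑ x, D.base x + 2 * D.amp * ∑ x, D.base x * D.dir x * r (D.block x)
            + ∑ x, D.base x * (D.amp ^ 2 * (D.dir x ^ 2 * r (D.block x) ^ 2)) := by
            rw [Finset.mul_sum, ← Finset.sum_add_distrib, ← Finset.sum_add_distrib]
            exact Finset.sum_congr rfl fun x _ => by rw [he]; ring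
        _ = _ := by rw [h0, D.base_sum]; ring
    have h2 : ∑ x, D.base x * (D.amp ^ 2 * (D.dir x ^ 2 * r (D.block x) ^ 2))
        ≤ ∑ x, D.base x * (D.amp ^ 2 * θ ^ 2) := by
      refine Finset.sum_le_sum fun x _ => mul_le_mul_of_nonneg_left ?_ (D.base_nonneg x)
      refine mul_le_mul_of_nonneg_left ?_ (sq_nonneg _)
      have h3 : D.dir x ^ 2 ≤ 1 := by
        rw [← sq_abs]; exact pow_le_one₀ (abs_nonneg _) (D.abs_dir_le_one x)
      have h4 : r (D.block x) ^ 2 ≤ θ ^ 2 := by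
        rw [← sq_abs]; exact pow_le_pow_left₀ (abs_nonneg _) (hr _) 2
      nlinarith [sq_nonneg (r (D.block x)), sq_nonneg (D.dir x)]
    rw [← Finset.sum_mul, D.base_sum, one_mul] at h2
    linarith
  have hg0 : 0 ≤ ∑ x, D.base x * g x ^ 2 :=
    Finset.sum_nonneg fun x _ => mul_nonneg (D.base_nonneg x) (sq_nonneg _)
  rw [← Real.sqrt_mul (by positivity)]
  exact Real.le_sqrt_of_sq_le (hcs.trans (mul_le_mul_of_nonneg_right he2 hg0))

/-! ### The mixture of the perturbations against the base distribution, without privacy -/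

theorem sum_pert_mul_eq (Z Z' : ι → Bool) :
    ∑ x, D.base x * ((1 + D.amp * (D.dir x * boolSign (Z (D.block x)))) *
        (1 + D.amp * (D.dir x * boolSign (Z' (D.block x)))))
      = 1 + D.amp ^ 2 * ∑ i, (∑ x with D.block x = i, D.base x * D.dir x ^ 2) *
          (boolSign (Z i) * boolSign (Z' i)) := by
  have h := D.sum_base_mul_dir_mul fun i => boolSign (Z i)
  have h' := D.sum_base_mul_dir_mul fun i => boolSign (Z' i)
  have h2 : ∑ i, (∑ x with D.block x = i, D.base x * D.dir x ^ 2) *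
          (boolSign (Z i) * boolSign (Z' i))
      = ∑ x, D.base x * D.dir x ^ 2 *
          (boolSign (Z (D.block x)) * boolSign (Z' (D.block x))) := by
    rw [← Finset.sum_fiberwise Finset.univ D.block (fun x => D.base x * D.dir x ^ 2 *
          (boolSign (Z (D.block x)) * boolSign (Z' (D.block x))))]
    refine Finset.sum_congr rfl fun i _ => ?_
    rw [Finset.sum_mul]
    refine Finset.sum_congr rfl fun x hx => ?_
    rw [(Finset.mem_filter.1 hx).2]
  rw [h2]
  calc _ = ∑ x, D.base x + D.amp * ∑ x, D.base x * D.dir x * boolSign (Z (D.block x))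
        + D.amp * ∑ x, D.base x * D.dir x * boolSign (Z' (D.block x))
        + D.amp ^ 2 * ∑ x, D.base x * D.dir x ^ 2 *
          (boolSign (Z (D.block x)) * boolSign (Z' (D.block x))) := by
        simp only [Finset.mul_sum, ← Finset.sum_add_distrib]
        exact Finset.sum_congr rfl fun x _ => by ring
    _ = _ := by rw [h, h', D.base_sum]; ring

/-- The exponential moment of the correlation of a random sign vector with a fixed one. -/
theorem sum_exp_le (u : ι → ℝ) (Z : ι → Bool) :
    ∑ Z' : ι → Bool, Real.exp (∑ i, u i * (boolSign (Z i) * boolSign (Z' i)))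
      ≤ Fintype.card (ι → Bool) * Real.exp (∑ i, u i ^ 2 / 2) := by
  have h : ∀ Z' : ι → Bool, Real.exp (∑ i, u i * (boolSign (Z i) * boolSign (Z' i)))
      = ∏ i, Real.exp (u i * (boolSign (Z i) * boolSign (Z' i))) := fun Z' => Real.exp_sum _ _
  simp only [h]
  rw [← Fintype.prod_sum fun i b => Real.exp (u i * (boolSign (Z i) * boolSign b))]
  have h1 : ∀ i, ∑ b : Bool, Real.exp (u i * (boolSign (Z i) * boolSign b))
      = 2 * Real.cosh (u i) := by
    intro i
    rw [Real.cosh_eq, Fintype.sum_bool]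
    cases Z i <;> simp [boolSign] <;> ring
  simp only [h1]
  rw [Finset.prod_mul_distrib, Real.exp_sum]
  rw [Finset.prod_const, Finset.card_univ, Fintype.card_fun, Fintype.card_bool, Nat.cast_pow,
    Nat.cast_ofNat]
  exact mul_le_mul_of_nonneg_left
    (Finset.prod_le_prod (fun i _ => (Real.cosh_pos _).le)
      fun i _ => Real.cosh_le_exp_half_sq _) (by positivity)

/-- The second moment bound for the mixture of the perturbations: a function of the whole stream
has a mean under the mixture that is controlled by its mean square under the base distribution. -/
theorem sq_sum_iidMean_le {v : ℝ}
    (hv : ∑ i, (∑ x with D.block x = i, D.base x * D.dir x ^ 2) ^ 2 ≤ v)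
    (m : ℕ) (F : (Fin m → X) → ℝ) :
    (∑ Z, iidMean (D.pert Z) m F) ^ 2
      ≤ (Fintype.card (ι → Bool) : ℝ) ^ 2 * Real.exp (m ^ 2 * D.amp ^ 4 * v / 2)
        * iidMean D.base m fun s => F s ^ 2 := by
  set N : ℝ := ((Fintype.card (ι → Bool) : ℕ) : ℝ) with hN
  set e : (ι → Bool) → X → ℝ := fun Z x => 1 + D.amp * (D.dir x * boolSign (Z (D.block x)))
    with he
  set W : (Fin m → X) → ℝ := fun s => ∏ j, D.base (s j) with hW
  have hW0 : ∀ s, 0 ≤ W s := fun s => Finset.prod_nonneg fun _ _ => D.base_nonneg _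
  set L : (Fin m → X) → ℝ := fun s => ∑ Z, ∏ j, e Z (s j) with hL
  have hmix : ∑ Z, iidMean (D.pert Z) m F = ∑ s, W s * (L s * F s) := by
    unfold iidMean
    rw [Finset.sum_comm]
    refine Finset.sum_congr rfl fun s _ => ?_
    rw [hL, Finset.sum_mul, Finset.mul_sum]
    refine Finset.sum_congr rfl fun Z _ => ?_
    have : ∏ i, D.pert Z (s i) = W s * ∏ i, e Z (s i) := by
      rw [hW, ← Finset.prod_mul_distrib]; rfl
    rw [this]; ring
  have hcs : (∑ s, W s * (L s * F s)) ^ 2 ≤ (∑ s, W s * L s ^ 2) * ∑ s, W s * F s ^ 2 := by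
    refine Finset.sum_sq_le_sum_mul_sum_of_sq_le_mul _
      (fun s _ => mul_nonneg (hW0 s) (sq_nonneg _))
      (fun s _ => mul_nonneg (hW0 s) (sq_nonneg _)) fun s _ => le_of_eq (by ring)
  have hL2 : ∑ s, W s * L s ^ 2 ≤ N ^ 2 * Real.exp (m ^ 2 * D.amp ^ 4 * v / 2) := by
    have hexpand : ∑ s, W s * L s ^ 2
        = ∑ Z, ∑ Z', (∑ x, D.base x * (e Z x * e Z' x)) ^ m := by
      have : ∀ Z Z', (∑ x, D.base x * (e Z x * e Z' x)) ^ m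
          = ∑ s : Fin m → X, W s * ((∏ j, e Z (s j)) * ∏ j, e Z' (s j)) := by
        intro Z Z'
        rw [Fintype.sum_pow]
        refine Finset.sum_congr rfl fun s _ => ?_
        rw [Finset.prod_mul_distrib, Finset.prod_mul_distrib]
      simp only [this]
      calc ∑ s, W s * L s ^ 2
          = ∑ s, ∑ Z, ∑ Z', W s * ((∏ j, e Z (s j)) * ∏ j, e Z' (s j)) := by
            refine Finset.sum_congr rfl fun s _ => ?_
            rw [hL, sq, Finset.sum_mul_sum, Finset.mul_sum]
            exact Finset.sum_congr rfl fun Z _ => Finset.mul_sum _ _ _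
        _ = _ := by
            rw [Finset.sum_comm]
            exact Finset.sum_congr rfl fun Z _ => Finset.sum_comm
    rw [hexpand]
    set u : ι → ℝ := fun i =>
      m * D.amp ^ 2 * ∑ x with D.block x = i, D.base x * D.dir x ^ 2 with hu
    have hterm : ∀ Z Z', (∑ x, D.base x * (e Z x * e Z' x)) ^ m
        ≤ Real.exp (∑ i, u i * (boolSign (Z i) * boolSign (Z' i))) := by
      intro Z Z'
      have h0 : 0 ≤ ∑ x, D.base x * (e Z x * e Z' x) :=
        Finset.sum_nonneg fun x _ => mul_nonneg (D.base_nonneg x)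
          (mul_nonneg (D.factor_nonneg Z x) (D.factor_nonneg Z' x))
      rw [D.sum_pert_mul_eq Z Z'] at h0 ⊢
      set S := ∑ i, (∑ x with D.block x = i, D.base x * D.dir x ^ 2) *
          (boolSign (Z i) * boolSign (Z' i)) with hS
      have hexp : ∑ i, u i * (boolSign (Z i) * boolSign (Z' i)) = m * (D.amp ^ 2 * S) := by
        rw [hS, Finset.mul_sum, Finset.mul_sum]
        exact Finset.sum_congr rfl fun i _ => by rw [hu]; ring
      rw [hexp, Real.exp_nat_mul]
      refine pow_le_pow_left₀ h0 ?_ m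
      linarith [Real.add_one_le_exp (D.amp ^ 2 * S)]
    have hsumu : ∑ i, u i ^ 2 / 2 ≤ m ^ 2 * D.amp ^ 4 * v / 2 := by
      have : ∑ i, u i ^ 2 / 2 = m ^ 2 * D.amp ^ 4 *
          (∑ i, (∑ x with D.block x = i, D.base x * D.dir x ^ 2) ^ 2) / 2 := by
        rw [Finset.mul_sum, Finset.sum_div]
        exact Finset.sum_congr rfl fun i _ => by rw [hu]; ring
      rw [this]
      have h4 : 0 ≤ (m : ℝ) ^ 2 * D.amp ^ 4 := by positivity
      nlinarith [mul_le_mul_of_nonneg_left hv h4]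
    calc ∑ Z, ∑ Z', (∑ x, D.base x * (e Z x * e Z' x)) ^ m
        ≤ ∑ Z : ι → Bool, N * Real.exp (m ^ 2 * D.amp ^ 4 * v / 2) := by
          refine Finset.sum_le_sum fun Z _ => ?_
          refine (Finset.sum_le_sum fun Z' _ => hterm Z Z').trans ((sum_exp_le u Z).trans ?_)
          exact mul_le_mul_of_nonneg_left (Real.exp_le_exp.2 hsumu) (by positivity)
      _ = _ := by
          rw [Finset.sum_const, Finset.card_univ, nsmul_eq_mul, ← hN]; ring
  rw [hmix]
  exact hcs.trans (mul_le_mul_of_nonneg_right hL2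
    (Finset.sum_nonneg fun s _ => mul_nonneg (hW0 s) (sq_nonneg _)))

end BlockPerturbation

/-! ### Measures that are close on every event -/

section Measure

variable {I : Type*} [MeasurableSpace I]

/-- A measurable function with values in the unit interval is integrable. -/
theorem integrable_of_mem_Icc {μ : Measure I} [IsFiniteMeasure μ] {f : I → ℝ} (hf : Measurable f)
    (h : ∀ y, f y ∈ Set.Icc 0 1) : Integrable f μ :=
  Integrable.of_mem_Icc 0 1 hf.aemeasurable (ae_of_all _ h)

/-- The Radon-Nikodym theorem, for two measures that agree up to a factor `1 ± θ` on every event: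
the density is everywhere within `θ` of `1`. -/
theorem exists_density_near_one {μ ν : Measure I} [IsFiniteMeasure μ] [IsFiniteMeasure ν] {θ : ℝ}
    (hθ : 0 ≤ θ) (h : ∀ E, MeasurableSet E → |μ.real E - ν.real E| ≤ θ * ν.real E) :
    ∃ r : I → ℝ, Measurable r ∧ (∀ y, |r y| ≤ θ) ∧
      ∀ f : I → ℝ, ∫ y, f y ∂μ = ∫ y, (1 + r y) * f y ∂ν := by
  have hac : μ ≪ ν := by
    refine Measure.AbsolutelyContinuous.mk fun E hE h0 => ?_
    have h1 := h E hE
    have h2 : ν.real E = 0 := by simp [Measure.real, h0]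
    rw [h2, mul_zero, sub_zero] at h1
    have h3 : μ.real E = 0 := abs_eq_zero.1 (le_antisymm h1 (abs_nonneg _))
    exact (measureReal_eq_zero_iff).1 h3
  set ρ : I → ℝ := fun y => (μ.rnDeriv ν y).toReal with hρ
  have hρm : Measurable ρ := (Measure.measurable_rnDeriv μ ν).ennreal_toReal
  have hρi : Integrable ρ ν := Measure.integrable_toReal_rnDeriv
  have hset : ∀ E, ∫ y in E, ρ y ∂ν = μ.real E := fun E =>
    Measure.setIntegral_toReal_rnDeriv hac E
  have hup : ρ ≤ᵐ[ν] fun _ => 1 + θ := by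
    refine ae_le_of_forall_setIntegral_le hρi (integrable_const _) fun E hE _ => ?_
    rw [hset, setIntegral_const, smul_eq_mul]
    linarith [(abs_le.1 (h E hE)).2]
  have hlo : (fun _ => 1 - θ) ≤ᵐ[ν] ρ := by
    refine ae_le_of_forall_setIntegral_le (integrable_const _) hρi fun E hE _ => ?_
    rw [hset, setIntegral_const, smul_eq_mul]
    linarith [(abs_le.1 (h E hE)).1]
  refine ⟨fun y => max (-θ) (min θ (ρ y - 1)), by fun_prop, fun y => ?_, fun f => ?_⟩
  · rw [abs_le]
    exact ⟨le_max_left _ _, max_le (by linarith) (min_le_left _ _)⟩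
  · rw [← integral_rnDeriv_smul hac]
    refine integral_congr_ae ?_
    filter_upwards [hup, hlo] with y h1 h2
    have h3 : max (-θ) (min θ (ρ y - 1)) = ρ y - 1 := by
      rw [min_eq_right (by linarith), max_eq_right (by linarith)]
    rw [h3, smul_eq_mul]
    ring

theorem sq_integral_le {μ : Measure I} [IsProbabilityMeasure μ] {f : I → ℝ} (hf : Measurable f)
    (h : ∀ y, f y ∈ Set.Icc 0 1) : (∫ y, f y ∂μ) ^ 2 ≤ ∫ y, f y ^ 2 ∂μ := by
  set c := ∫ y, f y ∂μ with hc
  have hi := integrable_of_mem_Icc (μ := μ) hf h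
  have hi2 : Integrable (fun y => f y ^ 2) μ := integrable_of_mem_Icc (hf.pow_const 2) fun y =>
    ⟨sq_nonneg _, pow_le_one₀ (h y).1 (h y).2⟩
  have h0 : 0 ≤ ∫ y, (f y - c) ^ 2 ∂μ := integral_nonneg fun y => sq_nonneg _
  have h1 : ∫ y, (f y - c) ^ 2 ∂μ = ∫ y, f y ^ 2 ∂μ - c ^ 2 := by
    have : ∀ y, (f y - c) ^ 2 = f y ^ 2 - 2 * c * f y + c ^ 2 := fun y => by ring
    simp only [this]
    have hs : Integrable (fun y => f y ^ 2 - 2 * c * f y) μ := hi2.sub (hi.const_mul _)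
    rw [integral_add hs (integrable_const _),
      integral_sub hi2 (hi.const_mul _), integral_const_mul, ← hc]
    simp
    ring
  linarith

end Measure

/-! ### Means under a stream algorithm -/

namespace StreamAlgorithm

variable {X I O : Type*} [MeasurableSpace X] [MeasurableSpace I] [MeasurableSpace O]
  (A : StreamAlgorithm X I O)

theorem run_append (l l' : List X) : A.run (l ++ l') = A.run l' ∘ₖ A.run l := by
  induction l with
  | nil => simp [run]
  | cons x l ih => rw [List.cons_append, run, ih, run, Kernel.comp_assoc]

theorem stateLaw_concat (l : List X) (x : X) :
    A.stateLaw (l ++ [x]) = A.step.sectL x ∘ₘ A.stateLaw l := by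
  rw [stateLaw, run_append, stateLaw, Measure.comp_assoc]
  simp [run]

/-- The mean of `f` at the state that is reached after the stream `s`. -/
noncomputable def stateMean {t : ℕ} (f : I → ℝ) (s : Fin t → X) : ℝ :=
  ∫ y, f y ∂A.stateLaw (List.ofFn s)

/-- The mean of `f` after one more update with the stream element `x`. -/
noncomputable def stepMean (f : I → ℝ) (x : X) (y : I) : ℝ := ∫ z, f z ∂A.step (y, x)

variable {A} {f : I → ℝ}

theorem measurable_stepMean (hf : Measurable f) (x : X) : Measurable (A.stepMean f x) := by
  have h : StronglyMeasurable fun p : I × X => ∫ z, f z ∂A.step p :=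
    hf.stronglyMeasurable.integral_kernel
  exact h.measurable.comp measurable_prodMk_right

theorem integral_mem_Icc {μ : Measure I} [IsProbabilityMeasure μ] (hf : Measurable f)
    (h : ∀ y, f y ∈ Set.Icc 0 1) : ∫ y, f y ∂μ ∈ Set.Icc 0 1 := by
  refine ⟨integral_nonneg fun y => (h y).1, ?_⟩
  calc ∫ y, f y ∂μ ≤ ∫ _, (1 : ℝ) ∂μ :=
        integral_mono (integrable_of_mem_Icc hf h) (integrable_const _) fun y => (h y).2
    _ = 1 := by simp

theorem stepMean_mem_Icc (hf : Measurable f) (h : ∀ y, f y ∈ Set.Icc 0 1) (x : X) (y : I) :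
    A.stepMean f x y ∈ Set.Icc 0 1 := integral_mem_Icc hf h

theorem stateMean_mem_Icc (hf : Measurable f) (h : ∀ y, f y ∈ Set.Icc 0 1) {t : ℕ}
    (s : Fin t → X) : A.stateMean f s ∈ Set.Icc 0 1 := integral_mem_Icc hf h

theorem stateMean_snoc (hf : Measurable f) (h : ∀ y, f y ∈ Set.Icc 0 1) {t : ℕ} (s : Fin t → X)
    (x : X) : A.stateMean f (Fin.snoc (α := fun _ => X) s x) = A.stateMean (A.stepMean f x) s := by
  unfold stateMean
  have hl : List.ofFn (Fin.snoc (α := fun _ => X) s x) = List.ofFn s ++ [x] := by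
    rw [List.ofFn_succ']
    simp
  have hi : Integrable f (A.step.sectL x ∘ₘ A.stateLaw (List.ofFn s)) := integrable_of_mem_Icc hf h
  rw [hl, stateLaw_concat]
  rw [Measure.comp_eq_comp_const_apply] at hi ⊢
  rw [Kernel.integral_comp hi]
  rfl

/-- The state at any time is a private function of the stream elements seen so far. -/
theorem PanPrivate.stateMean_le {m : ℕ} {ε : ℝ} (hA : A.PanPrivate m ε) {t : ℕ} (ht : t ≤ m)
    (hf : Measurable f) (h : ∀ y, f y ∈ Set.Icc 0 1) (s s' : Fin t → X) (j : Fin t)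
    (hs : ∀ i, i ≠ j → s i = s' i) : A.stateMean f s ≤ Real.exp ε * A.stateMean f s' := by
  -- The rest of the stream does not matter; it is filled up with some element.
  let pad : (Fin t → X) → Fin m → X := fun u i => if h : (i : ℕ) < t then u ⟨i, h⟩ else s j
  have hpad : ∀ u, (List.ofFn (pad u)).take t = List.ofFn u := by
    intro u
    refine List.ext_getElem (by simp [ht]) fun n h1 h2 => ?_
    have : n < t := by simpa using h2
    simp [pad, this]
  have hle : A.stateLaw (List.ofFn s) ≤
      ENNReal.ofReal (Real.exp ε) • A.stateLaw (List.ofFn s') := by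
    refine Measure.le_iff.2 fun E hE => ?_
    have hp := hA (pad s) (pad s') ⟨j, j.2.trans_le ht⟩ (fun i hi => ?_) t
      (Nat.one_le_of_lt j.2) ht (E ×ˢ Set.univ) (hE.prod MeasurableSet.univ)
    · have hv : ∀ u, A.viewLaw (List.ofFn (pad u)) t (E ×ˢ Set.univ)
          = A.stateLaw (List.ofFn u) E := by
        intro u
        rw [viewLaw, hpad, Measure.compProd_apply_prod hE MeasurableSet.univ]
        simp
      rw [hv, hv] at hp
      simpa using hp
    · by_cases hi' : (i : ℕ) < t
      · simp only [pad, hi', dif_pos]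
        exact hs _ fun h => hi (Fin.ext (by simpa using congrArg Fin.val h))
      · simp [pad, hi']
  calc A.stateMean f s
      ≤ ∫ y, f y ∂(ENNReal.ofReal (Real.exp ε) • A.stateLaw (List.ofFn s')) :=
        integral_mono_measure hle (ae_of_all _ fun y => (h y).1)
          ((integrable_of_mem_Icc hf h).smul_measure ENNReal.ofReal_ne_top)
    _ = _ := by
        rw [integral_smul_measure, ENNReal.toReal_ofReal (Real.exp_pos _).le]
        rfl

/-- A private state cannot tell two laws of the samples apart that are close in total variation. -/
theorem PanPrivate.iidMean_stateMean_le [Fintype X] [DecidableEq X] {m : ℕ} {ε : ℝ}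
    (hA : A.PanPrivate m ε) (hε : 0 ≤ ε) {t : ℕ} (ht : t ≤ m) (hf : Measurable f)
    (h : ∀ y, f y ∈ Set.Icc 0 1) {p p' : X → ℝ} (hp : ∀ x, 0 ≤ p x) (hp' : ∀ x, 0 ≤ p' x)
    (hp1 : ∑ x, p x = 1) (hp1' : ∑ x, p' x = 1) {τ : ℝ}
    (hτ : (1 / 2) * ∑ x, |p x - p' x| ≤ τ) :
    iidMean p t (A.stateMean f)
      ≤ Real.exp (t * (τ * (Real.exp ε - 1))) * iidMean p' t (A.stateMean f) := by
  have hτ0 : 0 ≤ τ := le_trans (by positivity) hτ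
  have hC : 1 ≤ Real.exp ε := Real.one_le_exp hε
  have h0 : ∀ s : Fin t → X, 0 ≤ A.stateMean f s := fun s => (stateMean_mem_Icc hf h s).1
  refine (iidMean_le_of_stable hp hp' hp1 hp1' hτ hC t _ h0
    fun s s' j hs => hA.stateMean_le ht hf h s s' j hs).trans ?_
  refine mul_le_mul_of_nonneg_right ?_ (iidMean_nonneg hp' h0)
  rw [Real.exp_nat_mul]
  refine pow_le_pow_left₀ (by nlinarith) ?_ t
  linarith [Real.add_one_le_exp (τ * (Real.exp ε - 1))]

end StreamAlgorithm

/-! ### The mixture of the perturbations against the base distribution, under privacy -/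

section WeightedSum

variable {I β : Type*} [MeasurableSpace I] [Fintype β]

/-- The combination of finitely many measures with real weights. -/
noncomputable def weightedSum (W : β → ℝ) (μ : β → Measure I) : Measure I :=
  ∑ b, ENNReal.ofReal (W b) • μ b

instance (W : β → ℝ) (μ : β → Measure I) [∀ b, IsProbabilityMeasure (μ b)] :
    IsFiniteMeasure (weightedSum W μ) := by
  refine ⟨?_⟩
  simp [weightedSum, ENNReal.sum_lt_top]

theorem integral_weightedSum {W : β → ℝ} (hW : ∀ b, 0 ≤ W b) (μ : β → Measure I)
    [∀ b, IsProbabilityMeasure (μ b)] {f : I → ℝ} (hf : Measurable f)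
    (h : ∀ y, f y ∈ Set.Icc 0 1) :
    ∫ y, f y ∂weightedSum W μ = ∑ b, W b * ∫ y, f y ∂μ b := by
  unfold weightedSum
  rw [integral_finsetSum_measure fun b _ =>
    (integrable_of_mem_Icc hf h).smul_measure ENNReal.ofReal_ne_top]
  refine Finset.sum_congr rfl fun b _ => ?_
  rw [integral_smul_measure, ENNReal.toReal_ofReal (hW b), smul_eq_mul]

end WeightedSum

namespace StreamAlgorithm

variable {X ι I O : Type*} [MeasurableSpace X] [MeasurableSpace I] [MeasurableSpace O]
  [Fintype X] [DecidableEq X] [Fintype ι] [DecidableEq ι]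
  {A : StreamAlgorithm X I O} {m : ℕ} {ε : ℝ}

/-- A private state is almost uncorrelated with the sign of any single block, even on events of small
probability: flipping the sign changes its law by a factor close to one. -/
theorem PanPrivate.abs_sum_boolSign_mul_le (hA : A.PanPrivate m ε) (hε : 0 ≤ ε)
    (D : BlockPerturbation X ι) {w : ℝ}
    (hw : ∀ i, ∑ x with D.block x = i, D.base x * |D.dir x| ≤ w) {t : ℕ} (ht : t ≤ m)
    {f : I → ℝ} (hf : Measurable f) (h : ∀ y, f y ∈ Set.Icc 0 1) (i : ι) :
    |∑ Z, boolSign (Z i) * iidMean (D.pert Z) t (A.stateMean f)|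
      ≤ m * (D.amp * w * (Real.exp ε - 1)) * ∑ Z, iidMean (D.pert Z) t (A.stateMean f) := by
  set M : (ι → Bool) → ℝ := fun Z => iidMean (D.pert Z) t (A.stateMean f) with hM
  set θ := m * (D.amp * w * (Real.exp ε - 1)) with hθ
  have hM0 : ∀ Z, 0 ≤ M Z := fun Z =>
    iidMean_nonneg (D.pert_nonneg Z) fun s => (stateMean_mem_Icc hf h s).1
  have hw0 : 0 ≤ w := le_trans
    (Finset.sum_nonneg fun x _ => mul_nonneg (D.base_nonneg x) (abs_nonneg _)) (hw i)
  have hC : 0 ≤ Real.exp ε - 1 := by linarith [Real.one_le_exp hε]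
  have hstep : ∀ Z, M Z - M (BlockPerturbation.flip i Z) ≤ θ * M Z := by
    intro Z
    have h1 : M Z ≤ Real.exp (t * (D.amp * w * (Real.exp ε - 1))) *
        M (BlockPerturbation.flip i Z) :=
      hA.iidMean_stateMean_le hε ht hf h (D.pert_nonneg _) (D.pert_nonneg _) (D.pert_sum _)
        (D.pert_sum _) (D.tv_flip_le hw i Z)
    have h2 : (t : ℝ) * (D.amp * w * (Real.exp ε - 1)) ≤ θ := by
      have : (t : ℝ) ≤ m := by exact_mod_cast ht
      exact mul_le_mul_of_nonneg_right this (mul_nonneg (mul_nonneg D.amp_nonneg hw0) hC)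
    have h3 : M Z ≤ Real.exp θ * M (BlockPerturbation.flip i Z) :=
      h1.trans (mul_le_mul_of_nonneg_right (Real.exp_le_exp.2 h2) (hM0 _))
    have h4 : Real.exp (-θ) * M Z ≤ M (BlockPerturbation.flip i Z) := by
      rw [Real.exp_neg, inv_mul_le_iff₀ (Real.exp_pos _)]
      exact h3
    nlinarith [hM0 Z, Real.add_one_le_exp (-θ)]
  have habs : ∀ Z, |M Z - M (BlockPerturbation.flip i Z)|
      ≤ θ * (M Z + M (BlockPerturbation.flip i Z)) := by
    intro Z
    have hθ0 : 0 ≤ θ := by rw [hθ]; have := D.amp_nonneg; positivity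
    have h1 := hstep Z
    have h2 := hstep (BlockPerturbation.flip i Z)
    rw [BlockPerturbation.flip_involutive i Z] at h2
    have h3 := mul_nonneg hθ0 (hM0 Z)
    have h4 := mul_nonneg hθ0 (hM0 (BlockPerturbation.flip i Z))
    rw [abs_le]
    constructor <;> linarith
  have hsym : ∑ Z, boolSign (Z i) * M Z
      = (1 / 2) * ∑ Z, boolSign (Z i) * (M Z - M (BlockPerturbation.flip i Z)) := by
    have h1 := BlockPerturbation.sum_flip i fun Z => boolSign (Z i) * M Z
    simp only [BlockPerturbation.boolSign_flip, neg_mul, Finset.sum_neg_distrib] at h1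
    simp only [mul_sub, Finset.sum_sub_distrib]
    linarith
  have hsum : ∑ Z, (M Z + M (BlockPerturbation.flip i Z)) = 2 * ∑ Z, M Z := by
    rw [Finset.sum_add_distrib, BlockPerturbation.sum_flip i M]
    ring
  rw [hsym, abs_mul, abs_of_pos (by norm_num : (0 : ℝ) < 1 / 2)]
  have hfin : |∑ Z, boolSign (Z i) * (M Z - M (BlockPerturbation.flip i Z))|
      ≤ θ * (2 * ∑ Z, M Z) := by
    rw [← hsum, Finset.mul_sum]
    refine (Finset.abs_sum_le_sum_abs _ _).trans (Finset.sum_le_sum fun Z _ => ?_)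
    rw [abs_mul, abs_boolSign, one_mul]
    exact habs Z
  linarith

/-- The posterior means of the block signs given a private state. The measure `ν` is the sum over all
sign vectors of the laws of the state, and weighting the summands by the sign of block `i` multiplies
`ν` by a density `r i`, which is the posterior mean of that sign and is bounded everywhere. -/
theorem PanPrivate.exists_posterior (hA : A.PanPrivate m ε) (hε : 0 ≤ ε)
    (D : BlockPerturbation X ι) {w : ℝ} (hw0 : 0 ≤ w)
    (hw : ∀ i, ∑ x with D.block x = i, D.base x * |D.dir x| ≤ w) {t : ℕ} (ht : t ≤ m) :
    ∃ (ν : Measure I) (r : ι → I → ℝ), IsFiniteMeasure ν ∧ (∀ i, Measurable (r i)) ∧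
      (∀ i y, |r i y| ≤ m * (D.amp * w * (Real.exp ε - 1))) ∧
      ∀ f : I → ℝ, Measurable f → (∀ y, f y ∈ Set.Icc 0 1) →
        ∑ Z, iidMean (D.pert Z) t (A.stateMean f) = ∫ y, f y ∂ν ∧
        ∀ i, ∑ Z, boolSign (Z i) * iidMean (D.pert Z) t (A.stateMean f)
          = ∫ y, r i y * f y ∂ν := by
  set W : (ι → Bool) × (Fin t → X) → ℝ := fun b => ∏ j, D.pert b.1 (b.2 j) with hW
  have hW0 : ∀ b, 0 ≤ W b := fun b => Finset.prod_nonneg fun _ _ => D.pert_nonneg _ _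
  set law : (ι → Bool) × (Fin t → X) → Measure I := fun b => A.stateLaw (List.ofFn b.2) with hlaw
  have hprob : ∀ b, IsProbabilityMeasure (law b) := fun b => by rw [hlaw]; infer_instance
  set ν : Measure I := weightedSum W law with hν
  -- The mixture of the laws with sign `+1` at block `i`, with weight two.
  set μ : ι → Measure I := fun i => weightedSum (fun b => (1 + boolSign (b.1 i)) * W b) law with hμ
  have hsign0 : ∀ b, 0 ≤ 1 + boolSign b := fun b => by cases b <;> simp [boolSign]
  have hνf : ∀ f : I → ℝ, Measurable f → (∀ y, f y ∈ Set.Icc 0 1) →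
      ∑ Z, iidMean (D.pert Z) t (A.stateMean f) = ∫ y, f y ∂ν := by
    intro f hf h
    rw [hν, integral_weightedSum hW0 law hf h, Fintype.sum_prod_type]
    rfl
  have hμf : ∀ i, ∀ f : I → ℝ, Measurable f → (∀ y, f y ∈ Set.Icc 0 1) →
      ∑ Z, boolSign (Z i) * iidMean (D.pert Z) t (A.stateMean f)
        = ∫ y, f y ∂μ i - ∫ y, f y ∂ν := by
    intro i f hf h
    rw [hν, hμ, integral_weightedSum hW0 law hf h,
      integral_weightedSum (fun b => mul_nonneg (hsign0 _) (hW0 b)) law hf h,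
      ← Finset.sum_sub_distrib, Fintype.sum_prod_type]
    refine Finset.sum_congr rfl fun Z _ => ?_
    rw [iidMean, Finset.mul_sum]
    refine Finset.sum_congr rfl fun s _ => ?_
    simp only [hW, hlaw, stateMean]
    ring
  have hθ0 : 0 ≤ m * (D.amp * w * (Real.exp ε - 1)) := by
    have := D.amp_nonneg
    have : 0 ≤ Real.exp ε - 1 := by linarith [Real.one_le_exp hε]
    positivity
  have hdens : ∀ i, ∃ r : I → ℝ, Measurable r ∧
      (∀ y, |r y| ≤ m * (D.amp * w * (Real.exp ε - 1))) ∧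
      ∀ f : I → ℝ, ∫ y, f y ∂μ i = ∫ y, (1 + r y) * f y ∂ν := by
    intro i
    refine exists_density_near_one hθ0 fun E hE => ?_
    have hEm : Measurable (E.indicator (1 : I → ℝ)) := measurable_one.indicator hE
    have hE01 : ∀ y, E.indicator (1 : I → ℝ) y ∈ Set.Icc (0 : ℝ) 1 := fun y => by
      by_cases hy : y ∈ E <;> simp [hy]
    have h1 := hA.abs_sum_boolSign_mul_le hε D hw ht hEm hE01 i
    rw [hμf i _ hEm hE01, hνf _ hEm hE01, integral_indicator_one hE,
      integral_indicator_one hE] at h1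
    exact h1
  choose r hrm hrb hrf using hdens
  refine ⟨ν, r, inferInstance, hrm, hrb, fun f hf h => ⟨hνf f hf h, fun i => ?_⟩⟩
  have hi : Integrable f ν := integrable_of_mem_Icc hf h
  have hri : Integrable (fun y => r i y * f y) ν :=
    hi.bdd_mul (hrm i).aestronglyMeasurable (ae_of_all _ fun y => hrb i y)
  rw [hμf i f hf h, hrf i f]
  simp only [add_mul, one_mul]
  rw [integral_add hi hri]
  ring

/-- The second moment bound for the mixture of the perturbations, for functions of a private state.
In each step the bound grows by the second moment of the predictive distribution of the next sample,
in which the perturbation `amp` is damped by the bound on the posterior means of the signs. -/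
theorem PanPrivate.sq_sum_iidMean_stateMean_le (hA : A.PanPrivate m ε) (hε : 0 ≤ ε)
    (D : BlockPerturbation X ι) {w : ℝ} (hw0 : 0 ≤ w)
    (hw : ∀ i, ∑ x with D.block x = i, D.base x * |D.dir x| ≤ w) (t : ℕ) (ht : t ≤ m)
    {f : I → ℝ} (hf : Measurable f) (h : ∀ y, f y ∈ Set.Icc 0 1) :
    (∑ Z, iidMean (D.pert Z) t (A.stateMean f)) ^ 2
      ≤ (Fintype.card (ι → Bool) : ℝ) ^ 2
        * (1 + D.amp ^ 2 * (m * (D.amp * w * (Real.exp ε - 1))) ^ 2) ^ t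
        * iidMean D.base t (A.stateMean fun y => f y ^ 2) := by
  set θ := m * (D.amp * w * (Real.exp ε - 1)) with hθ
  induction t generalizing f with
  | zero =>
    simp only [iidMean_zero, Finset.sum_const, Finset.card_univ, nsmul_eq_mul, pow_zero, mul_one]
    rw [mul_pow]
    exact mul_le_mul_of_nonneg_left (sq_integral_le hf h) (sq_nonneg _)
  | succ t ih =>
    obtain ⟨ν, r, _, hrm, hrb, hν⟩ := hA.exists_posterior hε D hw0 hw (Nat.le_of_succ_le ht)
    set g : X → I → ℝ := fun x => A.stepMean f x with hg
    have hgm : ∀ x, Measurable (g x) := measurable_stepMean hf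
    have hg01 : ∀ x y, g x y ∈ Set.Icc (0 : ℝ) 1 := stepMean_mem_Icc hf h
    set H : I → ℝ := fun y => √(∑ x, D.base x * g x y ^ 2) with hH
    have hHsq : ∀ y, H y ^ 2 = ∑ x, D.base x * g x y ^ 2 := fun y =>
      Real.sq_sqrt (Finset.sum_nonneg fun x _ => mul_nonneg (D.base_nonneg x) (sq_nonneg _))
    have hHm : Measurable H := by
      have : ∀ x, Measurable fun y => D.base x * g x y ^ 2 := fun x =>
        ((hgm x).pow_const 2).const_mul _
      exact (Finset.measurable_sum _ fun x _ => this x).sqrt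
    have hH01 : ∀ y, H y ∈ Set.Icc (0 : ℝ) 1 := by
      refine fun y => ⟨Real.sqrt_nonneg _, Real.sqrt_le_one.2 ?_⟩
      calc ∑ x, D.base x * g x y ^ 2 ≤ ∑ x, D.base x * 1 :=
            Finset.sum_le_sum fun x _ => mul_le_mul_of_nonneg_left
              (pow_le_one₀ (hg01 x y).1 (hg01 x y).2) (D.base_nonneg x)
        _ = 1 := by simp [D.base_sum]
    have hgi : ∀ x, Integrable (g x) ν := fun x => integrable_of_mem_Icc (hgm x) (hg01 x)
    have hrgi : ∀ x i, Integrable (fun y => r i y * g x y) ν := fun x i =>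
      (hgi x).bdd_mul (hrm i).aestronglyMeasurable (ae_of_all _ fun y => hrb i y)
    have hterm : ∀ x, Integrable
        (fun y => D.base x * ((1 + D.amp * D.dir x * r (D.block x) y) * g x y)) ν := by
      intro x
      have : Integrable (fun y => g x y + D.amp * D.dir x * (r (D.block x) y * g x y)) ν :=
        (hgi x).add ((hrgi x _).const_mul _)
      refine (this.const_mul (D.base x)).congr (ae_of_all _ fun y => ?_)
      ring
    -- One more sample, drawn from the predictive distribution given the state.
    have hmix : ∑ Z, iidMean (D.pert Z) (t + 1) (A.stateMean f)
        = ∫ y, ∑ x, D.base x * ((1 + D.amp * D.dir x * r (D.block x) y) * g x y) ∂ν := by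
      rw [integral_finsetSum _ fun x _ => hterm x]
      simp only [iidMean_succ', stateMean_snoc hf h]
      rw [Finset.sum_comm]
      refine Finset.sum_congr rfl fun x _ => ?_
      obtain ⟨h1, h2⟩ := hν (g x) (hgm x) (hg01 x)
      have h3 : ∫ y, (1 + D.amp * D.dir x * r (D.block x) y) * g x y ∂ν
          = ∫ y, g x y ∂ν + D.amp * D.dir x * ∫ y, r (D.block x) y * g x y ∂ν := by
        rw [← integral_const_mul, ← integral_add (hgi x) ((hrgi x _).const_mul _)]
        refine integral_congr_ae (ae_of_all _ fun y => ?_)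
        ring
      rw [integral_const_mul, h3, ← h1, ← h2, Finset.mul_sum, ← Finset.sum_add_distrib,
        Finset.mul_sum]
      refine Finset.sum_congr rfl fun Z _ => ?_
      simp only [hg, BlockPerturbation.pert]
      ring
    have hle : ∑ Z, iidMean (D.pert Z) (t + 1) (A.stateMean f)
        ≤ √(1 + D.amp ^ 2 * θ ^ 2) * ∑ Z, iidMean (D.pert Z) t (A.stateMean H) := by
      rw [hmix, (hν H hHm hH01).1, ← integral_const_mul]
      refine integral_mono (integrable_finsetSum _ fun x _ => hterm x)
        ((integrable_of_mem_Icc hHm hH01).const_mul _) fun y => ?_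
      exact D.sum_mul_le_sqrt (fun i => r i y) (fun i => hrb i y) fun x => g x y
    have hpos : 0 ≤ ∑ Z, iidMean (D.pert Z) (t + 1) (A.stateMean f) :=
      Finset.sum_nonneg fun Z _ => iidMean_nonneg (D.pert_nonneg Z)
        fun s => (stateMean_mem_Icc hf h s).1
    have hbase : iidMean D.base t (A.stateMean fun y => H y ^ 2)
        ≤ iidMean D.base (t + 1) (A.stateMean fun y => f y ^ 2) := by
      have hf2m : Measurable fun y => f y ^ 2 := hf.pow_const 2
      have hf201 : ∀ y, f y ^ 2 ∈ Set.Icc (0 : ℝ) 1 := fun y =>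
        ⟨sq_nonneg _, pow_le_one₀ (h y).1 (h y).2⟩
      rw [iidMean_succ]
      refine iidMean_mono D.base_nonneg fun s => ?_
      have hsq : ∀ x, Integrable (fun y => g x y ^ 2) (A.stateLaw (List.ofFn s)) := fun x =>
        integrable_of_mem_Icc ((hgm x).pow_const 2) fun y =>
          ⟨sq_nonneg _, pow_le_one₀ (hg01 x y).1 (hg01 x y).2⟩
      calc A.stateMean (fun y => H y ^ 2) s
          = ∑ x, D.base x * ∫ y, g x y ^ 2 ∂A.stateLaw (List.ofFn s) := by
            unfold stateMean
            simp only [hHsq]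
            rw [integral_finsetSum _ fun x _ => (hsq x).const_mul _]
            simp only [integral_const_mul]
        _ ≤ _ := by
            refine Finset.sum_le_sum fun x _ => mul_le_mul_of_nonneg_left ?_ (D.base_nonneg x)
            rw [stateMean_snoc hf2m hf201]
            exact integral_mono (hsq x)
              (integrable_of_mem_Icc (measurable_stepMean hf2m x) (stepMean_mem_Icc hf2m hf201 x))
              fun y => sq_integral_le hf h
    have hK : 0 ≤ 1 + D.amp ^ 2 * θ ^ 2 := by positivity
    calc (∑ Z, iidMean (D.pert Z) (t + 1) (A.stateMean f)) ^ 2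
        ≤ (√(1 + D.amp ^ 2 * θ ^ 2) * ∑ Z, iidMean (D.pert Z) t (A.stateMean H)) ^ 2 :=
          pow_le_pow_left₀ hpos hle 2
      _ = (1 + D.amp ^ 2 * θ ^ 2) * (∑ Z, iidMean (D.pert Z) t (A.stateMean H)) ^ 2 := by
          rw [mul_pow, Real.sq_sqrt hK]
      _ ≤ (1 + D.amp ^ 2 * θ ^ 2) * ((Fintype.card (ι → Bool) : ℝ) ^ 2
            * (1 + D.amp ^ 2 * θ ^ 2) ^ t
            * iidMean D.base (t + 1) (A.stateMean fun y => f y ^ 2)) := by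
          refine mul_le_mul_of_nonneg_left ((ih (Nat.le_of_succ_le ht) hHm hH01).trans ?_) hK
          exact mul_le_mul_of_nonneg_left hbase (by positivity)
      _ = _ := by ring

end StreamAlgorithm

/-! ### Uniformity testers -/

section Tester

variable {k : ℕ} {I : Type*} [MeasurableSpace I] {A : StreamAlgorithm (Fin k) I Verdict} {m : ℕ}

namespace StreamAlgorithm

/-- The probability that the answer is `v`, as a function of the final state. -/
noncomputable def verdictProb (A : StreamAlgorithm (Fin k) I Verdict) (v : Verdict) (y : I) : ℝ :=
  (A.output y).real {v}

theorem measurable_verdictProb (v : Verdict) : Measurable (A.verdictProb v) :=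
  (Kernel.measurable_coe A.output (MeasurableSet.of_discrete)).ennreal_toReal

theorem verdictProb_mem_Icc (v : Verdict) (y : I) : A.verdictProb v y ∈ Set.Icc 0 1 :=
  ⟨measureReal_nonneg, measureReal_le_one⟩

theorem verdictProb_add (y : I) :
    A.verdictProb Verdict.uniform y + A.verdictProb Verdict.nonUniform y = 1 := by
  have h : ({Verdict.uniform} : Set Verdict) ∪ {Verdict.nonUniform} = Set.univ := by
    ext v; cases v <;> simp
  unfold verdictProb
  rw [← measureReal_union (by simp) MeasurableSet.of_discrete, h]
  simp

theorem outputLaw_singleton (l : List (Fin k)) (v : Verdict) :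
    A.outputLaw l {v} = ENNReal.ofReal (∫ y, A.verdictProb v y ∂A.stateLaw l) := by
  rw [outputLaw, Measure.bind_apply MeasurableSet.of_discrete A.output.aemeasurable,
    ofReal_integral_eq_lintegral_ofReal
      (integrable_of_mem_Icc (measurable_verdictProb v) (verdictProb_mem_Icc v))
      (ae_of_all _ fun y => (verdictProb_mem_Icc v y).1)]
  refine lintegral_congr fun y => ?_
  simp [verdictProb, Measure.real]

end StreamAlgorithm

open StreamAlgorithm

theorem answerProb_eq (p : PMF (Fin k)) (v : Verdict) :
    answerProb A m p v =
      ENNReal.ofReal (iidMean (fun x => (p x).toReal) m (A.stateMean (A.verdictProb v))) := by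
  have h0 : ∀ s : Fin m → Fin k, 0 ≤ A.stateMean (A.verdictProb v) s := fun s =>
    (stateMean_mem_Icc (measurable_verdictProb v) (verdictProb_mem_Icc v) s).1
  unfold answerProb iidMean
  rw [lintegral_fintype, ENNReal.ofReal_sum_of_nonneg fun s _ =>
    mul_nonneg (Finset.prod_nonneg fun _ _ => ENNReal.toReal_nonneg) (h0 s)]
  refine Finset.sum_congr rfl fun s _ => ?_
  rw [outputLaw_singleton, Measure.pi_singleton,
    ENNReal.ofReal_mul (Finset.prod_nonneg fun _ _ => ENNReal.toReal_nonneg),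
    ENNReal.ofReal_prod_of_nonneg fun _ _ => ENNReal.toReal_nonneg, mul_comm]
  congr 1
  refine Finset.prod_congr rfl fun i _ => ?_
  rw [PMF.toMeasure_apply_singleton _ _ (measurableSet_singleton _),
    ENNReal.ofReal_toReal (p.apply_ne_top _)]

theorem iidMean_verdictProb_add {p : Fin k → ℝ} (hp1 : ∑ x, p x = 1) :
    iidMean p m (A.stateMean (A.verdictProb Verdict.uniform))
      + iidMean p m (A.stateMean (A.verdictProb Verdict.nonUniform)) = 1 := by
  have hi : ∀ v (s : Fin m → Fin k), Integrable (A.verdictProb v) (A.stateLaw (List.ofFn s)) :=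
    fun v s => integrable_of_mem_Icc (measurable_verdictProb v) (verdictProb_mem_Icc v)
  unfold iidMean
  rw [← Finset.sum_add_distrib]
  calc _ = ∑ s : Fin m → Fin k, ∏ i, p (s i) := by
        refine Finset.sum_congr rfl fun s _ => ?_
        rw [← mul_add, stateMean, stateMean, ← integral_add (hi _ s) (hi _ s)]
        simp [verdictProb_add]
    _ = (∑ x, p x) ^ m := (Fintype.sum_pow p m).symm
    _ = 1 := by rw [hp1, one_pow]

variable [NeZero k] {α : ℝ}

theorem le_of_two_thirds_le_ofReal {x : ℝ} (h : 2 / 3 ≤ ENNReal.ofReal x) : 2 / 3 ≤ x := by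
  have h1 : (2 / 3 : ℝ≥0∞) = ENNReal.ofReal (2 / 3) := by
    rw [ENNReal.ofReal_div_of_pos (by norm_num)]
    simp
  rw [h1] at h
  exact (ENNReal.ofReal_le_ofReal_iff'.1 h).resolve_right (by norm_num)

theorem IsUniformityTester.iidMean_uniform_le (h : IsUniformityTester A α m) :
    iidMean (fun _ => 1 / (k : ℝ)) m (A.stateMean (A.verdictProb Verdict.nonUniform)) ≤ 1 / 3 := by
  have h1 := h.1
  rw [answerProb_eq] at h1
  have hu : (fun x => ((PMF.uniformOfFintype (Fin k)) x).toReal) = fun _ => 1 / (k : ℝ) := by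
    ext x; simp
  have hk : (k : ℝ) ≠ 0 := by exact_mod_cast NeZero.ne k
  have h2 : (2 / 3 : ℝ) ≤
      iidMean (fun _ => 1 / (k : ℝ)) m (A.stateMean (A.verdictProb Verdict.uniform)) := by
    rw [hu] at h1
    exact le_of_two_thirds_le_ofReal h1
  have h3 := iidMean_verdictProb_add (A := A) (m := m) (p := fun _ => 1 / (k : ℝ)) (by simp [hk])
  linarith

theorem IsUniformityTester.le_iidMean (h : IsUniformityTester A α m) {p : Fin k → ℝ}
    (hp : ∀ x, 0 ≤ p x) (hp1 : ∑ x, p x = 1) (hα : α ≤ (1 / 2) * ∑ x, |p x - 1 / (k : ℝ)|) :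
    2 / 3 ≤ iidMean p m (A.stateMean (A.verdictProb Verdict.nonUniform)) := by
  set P : PMF (Fin k) := PMF.ofFintype (fun x => ENNReal.ofReal (p x)) (by
    rw [← ENNReal.ofReal_sum_of_nonneg fun x _ => hp x, hp1, ENNReal.ofReal_one]) with hP
  have hPx : (fun x => (P x).toReal) = p := by
    ext x
    rw [hP, PMF.ofFintype_apply, ENNReal.toReal_ofReal (hp x)]
  have h1 := h.2 P (by
    unfold tvDist
    have hPx' : ∀ x, (P x).toReal = p x := congrFun hPx
    simp only [hPx']
    simpa using hα)
  rw [answerProb_eq, hPx] at h1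
  exact le_of_two_thirds_le_ofReal h1

end Tester

/-! ### The bound from a single alternative -/

theorem one_sub_inv_le_of_le_exp {c x : ℝ} (hc : 0 < c) (h : c ≤ Real.exp x) : 1 - c⁻¹ ≤ x :=
  (Real.one_sub_inv_le_log_of_pos hc).trans ((Real.log_le_iff_le_exp hc).2 h)

section Bounds

open StreamAlgorithm

variable {k : ℕ} [NeZero k] {I : Type*} [MeasurableSpace I]
  {A : StreamAlgorithm (Fin k) I Verdict} {m : ℕ} {ε α : ℝ}

/-- The uniform distribution is compared with its mixture with a point mass, whose distance to it is
between `α` and `2 α`. -/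
theorem half_le_of_tester (hk : 2 ≤ k) (hε : 0 ≤ ε) (hα : 0 < α) (hα' : α ≤ 1 / 2)
    (hA : A.PanPrivate m ε) (hT : IsUniformityTester A α m) :
    1 / 2 ≤ m * (2 * α * (Real.exp ε - 1)) := by
  have hk2 : (2 : ℝ) ≤ k := by exact_mod_cast hk
  set u : ℝ := 1 / (k : ℝ) with hu
  have hu0 : 0 < u := by positivity
  have hku : (k : ℝ) * u = 1 := by rw [hu]; field_simp
  have hu2 : u ≤ 1 / 2 := by nlinarith
  set p : Fin k → ℝ := fun x => (1 - 2 * α) * u + if x = 0 then 2 * α else 0 with hp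
  have hp0 : ∀ x, 0 ≤ p x := fun x => by
    have : 0 ≤ (1 - 2 * α) * u := mul_nonneg (by linarith) hu0.le
    simp only [hp]
    split_ifs <;> linarith
  have hp1 : ∑ x, p x = 1 := by
    simp only [hp, Finset.sum_add_distrib, Finset.sum_const, Finset.card_univ, Fintype.card_fin,
      nsmul_eq_mul, Finset.sum_ite_eq', Finset.mem_univ, if_true]
    linear_combination (1 - 2 * α) * hku
  have htv : (1 / 2) * ∑ x, |p x - u| = 2 * α * (1 - u) := by
    have h1 : ∀ x, |p x - u| = 2 * α * u + if x = 0 then 2 * α * (1 - 2 * u) else 0 := by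
      intro x
      simp only [hp]
      split_ifs
      · rw [abs_of_nonneg (by nlinarith)]; ring
      · rw [abs_of_nonpos (by nlinarith)]; ring
    simp only [h1, Finset.sum_add_distrib, Finset.sum_const, Finset.card_univ, Fintype.card_fin,
      nsmul_eq_mul, Finset.sum_ite_eq', Finset.mem_univ, if_true]
    linear_combination α * hku
  have h23 := hT.le_iidMean hp0 hp1 (by rw [← hu, htv]; nlinarith)
  have h13 := hT.iidMean_uniform_le
  have hle := hA.iidMean_stateMean_le hε le_rfl (measurable_verdictProb (A := A) Verdict.nonUniform)
    (verdictProb_mem_Icc _) hp0 (fun _ => hu0.le) hp1 (by simp [hku]) (τ := 2 * α)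
    (by rw [htv]; nlinarith)
  have hexp := Real.exp_pos (m * (2 * α * (Real.exp ε - 1)))
  have h2 : (2 : ℝ) ≤ Real.exp (m * (2 * α * (Real.exp ε - 1))) := by
    have := mul_le_mul_of_nonneg_left h13 hexp.le
    linarith
  have := one_sub_inv_le_of_le_exp two_pos h2
  linarith

/-! ### The bounds from a mixture of alternatives -/

/-- If all perturbations are `α`-far from uniform, but their base distribution is mostly judged to be
uniform, then both second moment bounds are far from one. -/
theorem BlockPerturbation.le_of_tester {ι : Type*} [Fintype ι] [DecidableEq ι]
    (D : BlockPerturbation (Fin k) ι) {w : ℝ} (hw0 : 0 ≤ w)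
    (hw : ∀ i, ∑ x with D.block x = i, D.base x * |D.dir x| ≤ w)
    (hε : 0 ≤ ε) (hA : A.PanPrivate m ε) (hT : IsUniformityTester A α m)
    (hfar : ∀ Z, α ≤ (1 / 2) * ∑ x, |D.pert Z x - 1 / (k : ℝ)|)
    (hbase : iidMean D.base m (A.stateMean (A.verdictProb Verdict.nonUniform)) ≤ 7 / 18) :
    1 / 8 ≤ (m : ℝ) ^ 2 * D.amp ^ 4 * (Fintype.card ι * w ^ 2) / 2 ∧
    1 / 8 ≤ m * (D.amp ^ 2 * (m * (D.amp * w * (Real.exp ε - 1))) ^ 2) := by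
  set f := A.verdictProb Verdict.nonUniform with hf
  have hfm : Measurable f := measurable_verdictProb _
  have hf01 : ∀ y, f y ∈ Set.Icc (0 : ℝ) 1 := verdictProb_mem_Icc _
  set N : ℝ := ((Fintype.card (ι → Bool) : ℕ) : ℝ) with hN
  have hN0 : 0 < N := by rw [hN]; exact_mod_cast Fintype.card_pos
  have hmix : N * (2 / 3) ≤ ∑ Z, iidMean (D.pert Z) m (A.stateMean f) := by
    have : ∑ _Z : ι → Bool, (2 / 3 : ℝ) = N * (2 / 3) := by
      rw [Finset.sum_const, Finset.card_univ, nsmul_eq_mul]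
    rw [← this]
    exact Finset.sum_le_sum fun Z _ => hT.le_iidMean (D.pert_nonneg Z) (D.pert_sum Z) (hfar Z)
  have key : ∀ K L x : ℝ, K ≤ Real.exp L → 0 ≤ K → x ≤ 7 / 18 →
      (∑ Z, iidMean (D.pert Z) m (A.stateMean f)) ^ 2 ≤ N ^ 2 * K * x → 1 / 8 ≤ L := by
    intro K L x hKL hK hx hle
    have h1 : (N * (2 / 3)) ^ 2 ≤ N ^ 2 * K * (7 / 18) :=
      (pow_le_pow_left₀ (by positivity) hmix 2).trans
        (hle.trans (mul_le_mul_of_nonneg_left hx (by positivity)))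
    have h2 : 8 / 7 ≤ K := by
      have : N ^ 2 * (4 / 9) ≤ N ^ 2 * (K * (7 / 18)) := by linarith
      have := le_of_mul_le_mul_left this (by positivity)
      linarith
    have h3 := one_sub_inv_le_of_le_exp (by norm_num : (0 : ℝ) < 8 / 7) (h2.trans hKL)
    norm_num at h3 ⊢
    exact h3
  have hs01 : ∀ s : Fin m → Fin k, A.stateMean f s ∈ Set.Icc (0 : ℝ) 1 :=
    stateMean_mem_Icc hfm hf01
  constructor
  · refine key _ _ _ le_rfl (Real.exp_pos _).le ?_ (D.sq_sum_iidMean_le ?_ m _)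
    · refine (iidMean_mono D.base_nonneg fun s => ?_).trans hbase
      exact pow_le_of_le_one (hs01 s).1 (hs01 s).2 two_ne_zero
    · calc ∑ i, (∑ x with D.block x = i, D.base x * D.dir x ^ 2) ^ 2
          ≤ ∑ _i : ι, w ^ 2 := by
            refine Finset.sum_le_sum fun i _ => pow_le_pow_left₀ ?_ (le_trans ?_ (hw i)) 2
            · exact Finset.sum_nonneg fun x _ => mul_nonneg (D.base_nonneg x) (sq_nonneg _)
            · refine Finset.sum_le_sum fun x _ =>
                mul_le_mul_of_nonneg_left ?_ (D.base_nonneg x)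
              rw [← sq_abs]
              exact pow_le_of_le_one (abs_nonneg _) (D.abs_dir_le_one x) two_ne_zero
        _ = _ := by rw [Finset.sum_const, Finset.card_univ, nsmul_eq_mul]
  · refine key _ _ _ ?_ ?_ ?_ (hA.sq_sum_iidMean_stateMean_le hε D hw0 hw m le_rfl hfm hf01)
    · rw [Real.exp_nat_mul]
      refine pow_le_pow_left₀ (by positivity) ?_ m
      rw [add_comm]
      exact Real.add_one_le_exp _
    · positivity
    · refine (iidMean_mono D.base_nonneg fun s => ?_).trans hbase
      exact integral_mono
        (integrable_of_mem_Icc (hfm.pow_const 2) fun y =>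
          ⟨sq_nonneg _, pow_le_one₀ (hf01 y).1 (hf01 y).2⟩)
        (integrable_of_mem_Icc hfm hf01)
        fun y => pow_le_of_le_one (hf01 y).1 (hf01 y).2 two_ne_zero

end Bounds

/-! ### Pairs of neighbouring elements -/

section Pairing

variable {k : ℕ}

/-- The direction that is `+1` on the first and `-1` on the second element of each of the pairs
`{0, 1}, {2, 3}, …`, and `0` on the last element if that is left over. -/
def pairDir (x : Fin k) : ℝ :=
  if (x : ℕ) < 2 * (k / 2) then if (x : ℕ) % 2 = 0 then 1 else -1 else 0

/-- The index of the pair of `x`. -/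
def pairBlock (x : Fin k) : Fin k := ⟨x / 2, (Nat.div_le_self _ _).trans_lt x.2⟩

/-- The other element of the pair of `x`; the left over element is its own partner. -/
def pairPartner (x : Fin k) : Fin k :=
  if h : (x : ℕ) < 2 * (k / 2) then
    if h' : (x : ℕ) % 2 = 0 then ⟨x + 1, by omega⟩ else ⟨x - 1, by omega⟩
  else x

theorem abs_pairDir_le_one (x : Fin k) : |pairDir x| ≤ 1 := by
  unfold pairDir
  split_ifs <;> simp

theorem sum_pairDir (i : Fin k) : ∑ x with pairBlock x = i, pairDir x = 0 := by
  refine Finset.sum_involution (fun x _ => pairPartner x) ?_ ?_ ?_ ?_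
  · intro x _
    unfold pairDir pairPartner
    split_ifs <;> simp_all <;> omega
  · intro x _ hx h
    apply hx
    unfold pairDir pairPartner at *
    split_ifs at * <;> simp_all [Fin.ext_iff]
    omega
  · intro x hx
    simp only [Finset.mem_filter, Finset.mem_univ, true_and] at hx ⊢
    rw [← hx]
    refine Fin.ext ?_
    change (pairPartner x : ℕ) / 2 = x / 2
    unfold pairPartner
    split_ifs
    · change ((x : ℕ) + 1) / 2 = x / 2
      omega
    · change ((x : ℕ) - 1) / 2 = x / 2
      omega
    · rfl
  · intro x _
    by_cases h : (x : ℕ) < 2 * (k / 2)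
    · by_cases h' : (x : ℕ) % 2 = 0
      · have h1 : (x : ℕ) + 1 < 2 * (k / 2) := by omega
        have h2 : ¬((x : ℕ) + 1) % 2 = 0 := by omega
        simp [pairPartner, h, h', h1, h2]
      · have h1 : (x : ℕ) - 1 < 2 * (k / 2) := by omega
        have h2 : ((x : ℕ) - 1) % 2 = 0 := by omega
        have h3 : (x : ℕ) - 1 + 1 = x := by omega
        simp [pairPartner, h, h', h1, h2, h3]
    · simp [pairPartner, h]

theorem sum_pairDir_mul (g : Fin k → ℝ) : ∑ x, pairDir x * g (pairBlock x) = 0 := by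
  rw [← Finset.sum_fiberwise Finset.univ pairBlock]
  refine Finset.sum_eq_zero fun i _ => ?_
  rw [← zero_mul (g i), ← sum_pairDir i, Finset.sum_mul]
  refine Finset.sum_congr rfl fun x hx => ?_
  rw [(Finset.mem_filter.1 hx).2]

theorem card_pairBlock_le (i : Fin k) :
    (Finset.univ.filter fun x : Fin k => pairBlock x = i).card ≤ 2 := by
  have h : ((Finset.univ.filter fun x : Fin k => pairBlock x = i).image fun x : Fin k => (x : ℕ))
      ⊆ {2 * (i : ℕ), 2 * (i : ℕ) + 1} := by
    intro n hn
    simp only [Finset.mem_image, Finset.mem_filter, Finset.mem_univ, true_and] at hn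
    obtain ⟨x, hx, rfl⟩ := hn
    have : (x : ℕ) / 2 = i := by rw [← hx]; rfl
    simp only [Finset.mem_insert, Finset.mem_singleton]
    omega
  rw [← Finset.card_image_of_injective _ Fin.val_injective]
  exact (Finset.card_le_card h).trans Finset.card_le_two

theorem sum_ite_lt (c d : ℝ) :
    ∑ x : Fin k, (if (x : ℕ) < 2 * (k / 2) then c else d)
      = (2 * (k / 2) : ℕ) * c + (k - (2 * (k / 2) : ℕ)) * d := by
  have h : ∀ x : Fin k, (if (x : ℕ) < 2 * (k / 2) then c else d)
      = (if (x : ℕ) < 2 * (k / 2) then c - d else 0) + d := fun x => by split_ifs <;> ring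
  simp only [h, Finset.sum_add_distrib, ← Finset.sum_filter, Finset.sum_const,
    Fin.card_filter_val_lt, Finset.card_univ, Fintype.card_fin, nsmul_eq_mul]
  rw [min_eq_right (Nat.mul_div_le k 2)]
  ring

/-- The perturbations that shift mass inside the pairs, of a distribution that gives probability `q`
to each of the paired elements and `q'` to the element that is left over for odd `k`. -/
def pairing (q q' a : ℝ) (hq : 0 ≤ q) (hq' : 0 ≤ q')
    (hsum : (2 * (k / 2) : ℕ) * q + (k - (2 * (k / 2) : ℕ)) * q' = 1) (ha : 0 ≤ a) (ha' : a ≤ 1) :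
    BlockPerturbation (Fin k) (Fin k) where
  base x := if (x : ℕ) < 2 * (k / 2) then q else q'
  dir := pairDir
  block := pairBlock
  amp := a
  base_nonneg x := by split_ifs <;> assumption
  base_sum := by rw [sum_ite_lt, hsum]
  amp_nonneg := ha
  amp_le_one := ha'
  abs_dir_le_one := abs_pairDir_le_one
  balanced i := by
    have h : ∀ x : Fin k, (if (x : ℕ) < 2 * (k / 2) then q else q') * pairDir x
        = q * pairDir x := fun x => by
      unfold pairDir
      split_ifs <;> simp
    simp only [h]
    rw [← Finset.mul_sum, sum_pairDir, mul_zero]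

variable {q q' a : ℝ} (hq : 0 ≤ q) (hq' : 0 ≤ q')
    (hsum : (2 * (k / 2) : ℕ) * q + (k - (2 * (k / 2) : ℕ)) * q' = 1) (ha : 0 ≤ a) (ha' : a ≤ 1)

theorem pairing_block_mass_le (i : Fin k) :
    ∑ x with (pairing q q' a hq hq' hsum ha ha').block x = i,
      (pairing q q' a hq hq' hsum ha ha').base x * |(pairing q q' a hq hq' hsum ha ha').dir x|
      ≤ 2 * q := by
  simp only [pairing]
  calc _ ≤ ∑ x with pairBlock x = i, q := by
        refine Finset.sum_le_sum fun x _ => ?_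
        unfold pairDir
        split_ifs <;> simp [hq]
    _ ≤ 2 * q := by
        rw [Finset.sum_const, nsmul_eq_mul]
        exact mul_le_mul_of_nonneg_right (by exact_mod_cast card_pairBlock_le i) hq

/-- The perturbations are tested against the signs of their own directions. -/
theorem le_tv_pairing (Z : Fin k → Bool) (u : ℝ) :
    a * ((2 * (k / 2) : ℕ) * q) ≤ ∑ x, |(pairing q q' a hq hq' hsum ha ha').pert Z x - u| := by
  set e : Fin k → ℝ := fun x => pairDir x * boolSign (Z (pairBlock x)) with he
  have he1 : ∀ x, |e x| ≤ 1 := fun x => by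
    rw [he, abs_mul, abs_boolSign, mul_one]; exact abs_pairDir_le_one x
  have he0 : ∑ x, e x = 0 := sum_pairDir_mul fun i => boolSign (Z i)
  have hpt : ∀ x, e x * ((pairing q q' a hq hq' hsum ha ha').pert Z x - u)
      = (q - u) * e x + if (x : ℕ) < 2 * (k / 2) then a * q else 0 := by
    intro x
    have hs := boolSign_mul_self (Z (pairBlock x))
    simp only [he, BlockPerturbation.pert, pairing, pairDir]
    split_ifs
    · linear_combination a * q * hs
    · linear_combination a * q * hs
    · ring
  calc a * ((2 * (k / 2) : ℕ) * q)
      = ∑ x, e x * ((pairing q q' a hq hq' hsum ha ha').pert Z x - u) := by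
        simp only [hpt, Finset.sum_add_distrib]
        rw [← Finset.mul_sum, he0, sum_ite_lt]
        ring
    _ ≤ _ := by
        refine Finset.sum_le_sum fun x _ => (le_abs_self _).trans ?_
        rw [abs_mul]
        exact mul_le_of_le_one_left (abs_nonneg _) (he1 x)

end Pairing

/-! ### The lower bounds on the number of samples -/

section Bounds

open StreamAlgorithm

variable {k : ℕ} [NeZero k] {I : Type*} [MeasurableSpace I]
  {A : StreamAlgorithm (Fin k) I Verdict} {m : ℕ} {ε α : ℝ}

/-- The second moment bounds for the pairing, up to constants. For odd `k` and large `α`, the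
left over element has to get mass zero, and then the base distribution is not uniform; the second
alternative is that it can be told apart from the uniform distribution. -/
theorem pairing_bounds (hk : 2 ≤ k) (hε : 0 ≤ ε) (hα : 0 < α) (hα' : α ≤ 1 / 2)
    (hA : A.PanPrivate m ε) (hT : IsUniformityTester A α m) :
    (∃ a w : ℝ, 0 ≤ a ∧ a ≤ 6 * α ∧ 0 ≤ w ∧ k * w ≤ 3 ∧
      1 / 8 ≤ (m : ℝ) ^ 2 * a ^ 4 * (k * w ^ 2) / 2 ∧
      1 / 8 ≤ m * (a ^ 2 * (m * (a * w * (Real.exp ε - 1))) ^ 2)) ∨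
    (1 ≤ 6 * α ∧ k ≤ 7 * (m * (Real.exp ε - 1))) := by
  set n : ℝ := ((2 * (k / 2) : ℕ) : ℝ) with hn
  have hk0 : (0 : ℝ) < k := by exact_mod_cast (by omega : 0 < k)
  have hnk : n ≤ k := by rw [hn]; exact_mod_cast Nat.mul_div_le k 2
  have hkn : k ≤ n + 1 := by rw [hn]; exact_mod_cast (by omega : k ≤ 2 * (k / 2) + 1)
  have h23 : 2 * (k : ℝ) ≤ 3 * n := by
    rw [hn]; exact_mod_cast (by omega : 2 * k ≤ 3 * (2 * (k / 2)))
  have hn0 : 0 < n := by linarith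
  set f := A.verdictProb Verdict.nonUniform
  have hu := hT.iidMean_uniform_le
  rcases le_or_gt α (1 / 6) with hα6 | hα6
  · left
    set u : ℝ := 1 / (k : ℝ) with hudef
    have hu0 : 0 ≤ u := by positivity
    have hku : k * u = 1 := by rw [hudef]; field_simp
    have hsum : n * u + (k - n) * u = 1 := by linarith
    have hnu : 2 / 3 ≤ n * u := by nlinarith
    set D := pairing u u (3 * α) hu0 hu0 hsum (by linarith) (by linarith) with hD
    have hb : D.base = fun _ => u := by ext x; simp [hD, pairing]
    have h := D.le_of_tester (w := 2 * u) (by linarith) (pairing_block_mass_le _ _ _ _ _) hε hA hT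
      (fun Z => ?_) (by rw [hb]; linarith)
    · rw [Fintype.card_fin] at h
      exact ⟨3 * α, 2 * u, by linarith, by linarith, by linarith, by linarith, h.1, h.2⟩
    · have h1 : 3 * α * (n * u) ≤ ∑ x, |D.pert Z x - u| := le_tv_pairing _ _ _ _ _ Z u
      nlinarith
  · rcases le_or_gt ((k : ℝ)) (7 * (m * (Real.exp ε - 1))) with hm | hm
    · exact Or.inr ⟨by linarith, hm⟩
    left
    set u : ℝ := 1 / (k : ℝ) with hudef
    have hku : k * u = 1 := by rw [hudef]; field_simp
    have hu0 : 0 ≤ u := by positivity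
    set q : ℝ := 1 / n with hq
    have hq0 : 0 ≤ q := by positivity
    have hnq : n * q = 1 := by rw [hq]; field_simp
    have hsum : n * q + (k - n) * 0 = 1 := by linarith
    set D := pairing q 0 1 hq0 le_rfl hsum zero_le_one le_rfl with hD
    have htv : (1 / 2) * ∑ x, |D.base x - u| ≤ u := by
      have hquad : u ≤ q := by
        rw [hudef, hq]; exact one_div_le_one_div_of_le hn0 hnk
      have h1 : ∀ x, |D.base x - u| = if (x : ℕ) < 2 * (k / 2) then q - u else u := by
        intro x
        simp only [hD, pairing]
        split_ifs
        · exact abs_of_nonneg (by linarith)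
        · rw [zero_sub, abs_neg, abs_of_nonneg hu0]
      simp only [h1, sum_ite_lt]
      rw [← hn]
      nlinarith
    have hbase : iidMean D.base m (A.stateMean f) ≤ 7 / 18 := by
      have h1 := hA.iidMean_stateMean_le hε le_rfl
        (measurable_verdictProb (A := A) Verdict.nonUniform) (verdictProb_mem_Icc _)
        D.base_nonneg (fun _ => hu0) D.base_sum (by simp [hku]) htv
      have h2 : m * (u * (Real.exp ε - 1)) < 1 / 7 := by
        have : m * (u * (Real.exp ε - 1)) = u * (m * (Real.exp ε - 1)) := by ring
        rw [this, hudef, one_div, inv_mul_lt_iff₀ hk0]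
        linarith
      have h3 : Real.exp (m * (u * (Real.exp ε - 1))) ≤ 7 / 6 := by
        by_contra hcon
        have := one_sub_inv_le_of_le_exp (by norm_num) (not_le.1 hcon).le
        norm_num at this
        linarith
      have h4 : 0 ≤ iidMean (fun _ : Fin k => u) m (A.stateMean f) :=
        iidMean_nonneg (fun _ => hu0) fun s =>
          (stateMean_mem_Icc (measurable_verdictProb _) (verdictProb_mem_Icc _) s).1
      nlinarith [mul_le_mul_of_nonneg_right h3 h4]
    have h := D.le_of_tester (w := 2 * q) (by linarith) (pairing_block_mass_le _ _ _ _ _) hε hA hT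
      (fun Z => ?_) hbase
    · rw [Fintype.card_fin] at h
      exact ⟨1, 2 * q, zero_le_one, by linarith, by linarith, by nlinarith, h.1, h.2⟩
    · have h1 : 1 * (n * q) ≤ ∑ x, |D.pert Z x - u| := le_tv_pairing _ _ _ _ _ Z u
      linarith

/-- The three bounds in polynomial form. -/
theorem polynomial_bounds {ε₀ : ℝ} (hk : 2 ≤ k) (hε : 0 < ε) (hε₀ : ε ≤ ε₀) (hα : 0 < α)
    (hα' : α ≤ 1 / 2) (hA : A.PanPrivate m ε) (hT : IsUniformityTester A α m) :
    (k : ℝ) ^ 2 ≤ 444528 * Real.exp ε₀ ^ 4 * (m ^ 3 * α ^ 4 * ε ^ 2) ∧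
    (k : ℝ) ≤ 444528 * Real.exp ε₀ ^ 4 * (m ^ 2 * α ^ 4) ∧
    1 ≤ 444528 * Real.exp ε₀ ^ 4 * (m * α * ε) := by
  set C := Real.exp ε₀ with hC
  set E := Real.exp ε - 1 with hE
  set M : ℝ := (m : ℝ) with hM
  have hM0 : 0 ≤ M := Nat.cast_nonneg m
  have hC1 : 1 ≤ C := Real.one_le_exp (hε.le.trans hε₀)
  have hεC : ε ≤ C := by linarith [Real.add_one_le_exp ε₀]
  have hE0 : 0 ≤ E := by linarith [Real.one_le_exp hε.le]
  have hEC : E ≤ C * ε := by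
    have h1 : Real.exp ε ≤ C := Real.exp_le_exp.2 hε₀
    have h2 : Real.exp ε * Real.exp (-ε) = 1 := by rw [← Real.exp_add]; simp
    have h3 : Real.exp ε * (-ε + 1) ≤ Real.exp ε * Real.exp (-ε) :=
      mul_le_mul_of_nonneg_left (Real.add_one_le_exp _) (Real.exp_pos _).le
    have h4 := mul_le_mul_of_nonneg_right h1 hε.le
    linarith
  have hk1 : (1 : ℝ) ≤ k := by exact_mod_cast (by omega : 1 ≤ k)
  have hC14 : C ≤ C ^ 4 := le_self_pow₀ hC1 (by norm_num)
  have hC24 : C ^ 2 ≤ C ^ 4 := pow_le_pow_right₀ hC1 (by norm_num)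
  have hC04 : 1 ≤ C ^ 4 := one_le_pow₀ hC1
  refine ⟨?_, ?_, ?_⟩
  · rcases pairing_bounds hk hε.le hα hα' hA hT with ⟨a, w, ha, ha6, hw, hkw, -, h⟩ | ⟨h6, h⟩
    · have h1 : M * (a ^ 2 * (M * (a * w * E)) ^ 2) = M ^ 3 * (a ^ 4 * (w ^ 2 * E ^ 2)) := by ring
      rw [← hM, ← hE, h1] at h
      have h2 : (k : ℝ) ^ 2 * (M ^ 3 * (a ^ 4 * (w ^ 2 * E ^ 2)))
          ≤ M ^ 3 * ((6 * α) ^ 4 * (3 ^ 2 * (C * ε) ^ 2)) := by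
        calc _ = M ^ 3 * (a ^ 4 * ((k * w) ^ 2 * E ^ 2)) := by ring
          _ ≤ _ := by gcongr
      have h3 := mul_le_mul_of_nonneg_left h (sq_nonneg (k : ℝ))
      have h4 : 0 ≤ M ^ 3 * α ^ 4 * ε ^ 2 := by positivity
      have h5 := mul_le_mul_of_nonneg_right hC24 h4
      have h6 : M ^ 3 * ((6 * α) ^ 4 * (3 ^ 2 * (C * ε) ^ 2))
          = 11664 * (C ^ 2 * (M ^ 3 * α ^ 4 * ε ^ 2)) := by ring
      have h7 : 0 ≤ C ^ 4 * (M ^ 3 * α ^ 4 * ε ^ 2) := by positivity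
      linarith
    · rw [← hM, ← hE] at h
      have h1 : (k : ℝ) ≤ 7 * (M * (C * ε)) := h.trans (by gcongr)
      calc (k : ℝ) ^ 2 ≤ (k : ℝ) ^ 3 := pow_le_pow_right₀ hk1 (by norm_num)
        _ ≤ (7 * (M * (C * ε))) ^ 3 := by gcongr
        _ = 343 * C ^ 3 * M ^ 3 * ε ^ 2 * (ε * 1 ^ 4) := by ring
        _ ≤ 343 * C ^ 3 * M ^ 3 * ε ^ 2 * (C * (6 * α) ^ 4) := by gcongr
        _ = _ := by ring
  · rcases pairing_bounds hk hε.le hα hα' hA hT with ⟨a, w, ha, ha6, hw, hkw, h, -⟩ | ⟨h6, h⟩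
    · rw [← hM] at h
      have h2 : (k : ℝ) * (M ^ 2 * a ^ 4 * (k * w ^ 2)) ≤ M ^ 2 * (6 * α) ^ 4 * 3 ^ 2 := by
        calc _ = M ^ 2 * a ^ 4 * (k * w) ^ 2 := by ring
          _ ≤ _ := by gcongr
      have h3 := mul_le_mul_of_nonneg_left h (zero_le_one.trans hk1)
      have h4 : 0 ≤ M ^ 2 * α ^ 4 := by positivity
      have h5 := mul_le_mul_of_nonneg_right hC04 h4
      have h6 : M ^ 2 * (6 * α) ^ 4 * 3 ^ 2 = 11664 * (M ^ 2 * α ^ 4) := by ring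
      linarith
    · rw [← hM, ← hE] at h
      have h1 : (k : ℝ) ≤ 7 * (M * (C * ε)) := h.trans (by gcongr)
      calc (k : ℝ) ≤ (k : ℝ) ^ 2 := le_self_pow₀ hk1 (by norm_num)
        _ ≤ (7 * (M * (C * ε))) ^ 2 := by gcongr
        _ ≤ (7 * (M * (C * C))) ^ 2 := by gcongr
        _ = 49 * C ^ 4 * M ^ 2 * 1 ^ 4 := by ring
        _ ≤ 49 * C ^ 4 * M ^ 2 * (6 * α) ^ 4 := by gcongr
        _ = 63504 * (C ^ 4 * (M ^ 2 * α ^ 4)) := by ring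
        _ ≤ 444528 * (C ^ 4 * (M ^ 2 * α ^ 4)) := by gcongr; norm_num
        _ = _ := by ring
  · have h := half_le_of_tester hk hε.le hα hα' hA hT
    rw [← hM, ← hE] at h
    have h1 : M * (2 * α * E) ≤ M * (2 * α * (C * ε)) := by gcongr
    have h2 : 0 ≤ M * α * ε := by positivity
    have h3 := mul_le_mul_of_nonneg_right hC14 h2
    have h4 : 0 ≤ C ^ 4 * (M * α * ε) := by positivity
    have h5 : M * (2 * α * (C * ε)) = 2 * (C * (M * α * ε)) := by ring
    linarith

end Bounds

theorem theorem3 (ε₀ : ℝ) :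
    ∃ c : ℝ, 0 < c ∧
      ∀ (k : ℕ) [NeZero k] (ε α : ℝ) (m : ℕ) (I : Type*) [MeasurableSpace I]
        (A : StreamAlgorithm (Fin k) I Verdict),
        2 ≤ k → 0 < ε → ε ≤ ε₀ → 0 < α → α ≤ 1 / 2 →
        A.PanPrivate m ε → IsUniformityTester A α m →
          c * ((k : ℝ) ^ (2 / 3 : ℝ) / (α ^ (4 / 3 : ℝ) * ε ^ (2 / 3 : ℝ))
            + Real.sqrt k / α ^ 2 + 1 / (α * ε)) ≤ m := by
  set B : ℝ := 444528 * Real.exp ε₀ ^ 4 with hB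
  have hB0 : 0 < B := by positivity
  refine ⟨1 / (3 * (B + 1)), by positivity, ?_⟩
  intro k _ ε α m I _ A hk hε hε₀ hα hα' hA hT
  obtain ⟨h1, h2, h3⟩ := polynomial_bounds hk hε hε₀ hα hα' hA hT
  rw [← hB] at h1 h2 h3
  set M : ℝ := (m : ℝ) with hM
  have hM0 : 0 ≤ M := Nat.cast_nonneg m
  have hB1 : 1 ≤ B + 1 := by linarith
  have hBpow : ∀ n : ℕ, n ≠ 0 → B ≤ (B + 1) ^ n := fun n hn =>
    (by linarith : B ≤ B + 1).trans (le_self_pow₀ hB1 hn)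
  have hk0 : (0 : ℝ) ≤ k := Nat.cast_nonneg k
  have t1 : (k : ℝ) ^ (2 / 3 : ℝ) / (α ^ (4 / 3 : ℝ) * ε ^ (2 / 3 : ℝ)) ≤ (B + 1) * M := by
    refine le_of_pow_le_pow_left₀ three_ne_zero (by positivity) ?_
    have hcube : ((k : ℝ) ^ (2 / 3 : ℝ) / (α ^ (4 / 3 : ℝ) * ε ^ (2 / 3 : ℝ))) ^ 3
        = (k : ℝ) ^ 2 / (α ^ 4 * ε ^ 2) := by
      have hp : ∀ x : ℝ, 0 ≤ x → ∀ n : ℕ, (x ^ ((n : ℝ) / 3)) ^ 3 = x ^ n := by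
        intro x hx n
        rw [← Real.rpow_natCast (x ^ ((n : ℝ) / 3)) 3, ← Real.rpow_mul hx, ← Real.rpow_natCast x n]
        congr 1
        push_cast
        ring
      rw [div_pow, mul_pow]
      have e1 := hp k hk0 2
      have e2 := hp α hα.le 4
      have e3 := hp ε hε.le 2
      push_cast at e1 e2 e3
      rw [e1, e2, e3]
    rw [hcube, div_le_iff₀ (by positivity), mul_pow]
    calc (k : ℝ) ^ 2 ≤ B * (M ^ 3 * α ^ 4 * ε ^ 2) := h1
      _ ≤ (B + 1) ^ 3 * (M ^ 3 * α ^ 4 * ε ^ 2) :=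
        mul_le_mul_of_nonneg_right (hBpow 3 three_ne_zero) (by positivity)
      _ = _ := by ring
  have t2 : Real.sqrt k / α ^ 2 ≤ (B + 1) * M := by
    rw [div_le_iff₀ (by positivity)]
    refine Real.sqrt_le_iff.2 ⟨by positivity, ?_⟩
    calc (k : ℝ) ≤ B * (M ^ 2 * α ^ 4) := h2
      _ ≤ (B + 1) ^ 2 * (M ^ 2 * α ^ 4) :=
        mul_le_mul_of_nonneg_right (hBpow 2 two_ne_zero) (by positivity)
      _ = _ := by ring
  have t3 : 1 / (α * ε) ≤ (B + 1) * M := by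
    rw [div_le_iff₀ (by positivity)]
    calc 1 ≤ B * (M * α * ε) := h3
      _ ≤ (B + 1) * (M * α * ε) := mul_le_mul_of_nonneg_right (by linarith) (by positivity)
      _ = _ := by ring
  rw [one_div, inv_mul_le_iff₀ (by positivity)]
  linarith
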